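/- Let $\mathbb{H}$ be the Heisenberg group, realized as the group of matrices $$M(x,y,z)=\begin{pmatrix}1&x&-y&z\\0&1&0&y\\0&0&1&0\\0&0&0&1\end{pmatrix},\qquad x,y,z\in\mathbb{R},$$ with Lebesgue measure $dx\,dy\,dz$ as Haar measure. Let $a,b\in\mathbb{R}$ with $ab=2$ and $A=\mathrm{diag}(ab,b,a,1)$. For $f\in L^2(\mathbb{H})$, $m\in\mathbb{Z}$ and $\gamma,\eta\in\mathbb{H}$ put $$D_{A^m}f(n)=|\det A|^{-m/2}f(A^{-m}nA^m),\qquad \tau(\gamma,\eta)f(n)=f(\gamma^{-1}n\eta),$$ and let $$\Lambda=\{(M(k_3,k_2,k_1),\,M(m_3,m_2,0)) : k_1,k_2,k_3,m_2,m_3\in\mathbb{Z}\}.$$ For $\lambda\neq0$ let $\pi_\lambda$ be the Schrödinger representation on $L^2(\mathbb{R})$, $\pi_\lambda(M(x,y,z))u(t)=e^{2\pi i\lambda z}e^{-2\pi i\lambda yt}u(t-x)$, and let $\mathbf{P}$ be the Plancherel transform of $\mathbb{H}$, that is, the unitary extension of $f\mapsto\big(\int_{\mathbb{H}}f(n)\pi_\lambda(n)\,dn\big)_{\lambda\ne0}$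 from $L^1(\mathbb{H})\cap L^2(\mathbb{H})$ to $L^2(\mathbb{H})$, with values in the square integrable fields of Hilbert–Schmidt operators on $L^2(\mathbb{R})$ with respect to the measure $|\lambda|\,d\lambda$. For measurable $S\subseteq\mathbb{R}$ let $\mathbf{H}_S$ be the space of $f\in L^2(\mathbb{H})$ with $\mathbf{P}f(\lambda)=0$ for almost every $\lambda\notin S$. Sets that differ by a Lebesgue null set are identified. Measurable sets $I,J\subseteq\mathbb{R}$ are translation congruent if there are a bijection $\rho:I\to J$ and a measurable $k:I\to\mathbb{Z}$ with $\rho(\lambda)=\lambda+k(\lambda)$, and dilation congruent if there are a bijection $\delta:I\to J$ and a measurable $j:I\to\mathbb{Z}$ with $\delta(\lambda)=2^{j(\lambda)}\lambda$. A family $(e_i)$ in a Hilbert space is a Parseval frame if $\sum_i|\langle h,e_i\rangle|^2=\|h\|^2$ for every vector $h$. For $u\in L^2(\mathbb{R})$ let $\mathcal{G}(u,\mathbb{Z}\times\lambda\mathbb{Z})$ be the Gabor system $\big(t\mapsto e^{2\pi i\lambda kt}u(t-n)\big)_{n,k\in\mathbb{Z}}$. For $u,v\in L^2(\mathbb{R})$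 let $u\otimes v$ be the operator $w\mapsto\langle w,v\rangle u$. **Theorem.** Let $S\subseteq[-1,1]$ be a measurable set that is dilation congruent to $[-1,-1/2)\cup(1/2,1]$ and translation congruent to $(0,1]$. Let $f\in\mathbf{H}_S$ be such that $\mathbf{P}f(\lambda)=u_\lambda\otimes v_\lambda$ for almost every $\lambda\in S$, where $u_\lambda,v_\lambda\in L^2(\mathbb{R})$ and, for almost every $\lambda\in S$, both $\mathcal{G}(|\lambda|^{1/4}u_\lambda,\mathbb{Z}\times\lambda\mathbb{Z})$ and $\mathcal{G}(|\lambda|^{1/4}\overline{v_\lambda},\mathbb{Z}\times\lambda\mathbb{Z})$ are Parseval frames of $L^2(\mathbb{R})$. Then the family $$\{D_{A^m}\tau(\gamma,\eta)f : m\in\mathbb{Z},\ (\gamma,\eta)\in\Lambda\}$$ is a Parseval frame of $L^2(\mathbb{H})$. -/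

import Mathlib

open MeasureTheory Filter Topology
open scoped ENNReal

namespace HeisenbergWavelet

noncomputable section

/-! ### The Heisenberg group -/

/-- The Heisenberg group. The triple `(x, y, z)` stands for the unipotent matrix `Heis.toMatrix`
below, that is, for `exp (zZ) exp (yY) exp (xX)`. -/
def Heis : Type := ℝ × ℝ × ℝ

namespace Heis

def mk (x y z : ℝ) : Heis := (x, y, z)

def x (n : Heis) : ℝ := n.1

def y (n : Heis) : ℝ := n.2.1

def z (n : Heis) : ℝ := n.2.2

@[simp] theorem x_mk (x y z : ℝ) : (mk x y z).x = x := rfl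

@[simp] theorem y_mk (x y z : ℝ) : (mk x y z).y = y := rfl

@[simp] theorem z_mk (x y z : ℝ) : (mk x y z).z = z := rfl

@[ext] theorem ext {m n : Heis} (hx : m.x = n.x) (hy : m.y = n.y) (hz : m.z = n.z) : m = n :=
  Prod.ext hx (Prod.ext hy hz)

/-- The Haar measure of the group is the Lebesgue measure in the coordinates `(x, y, z)`. -/
instance : MeasureSpace Heis := inferInstanceAs (MeasureSpace (ℝ × ℝ × ℝ))

instance : Mul Heis := ⟨fun m n => mk (m.x + n.x) (m.y + n.y) (m.z + n.z + m.x * n.y)⟩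

instance : One Heis := ⟨mk 0 0 0⟩

instance : Inv Heis := ⟨fun m => mk (-m.x) (-m.y) (-m.z + m.x * m.y)⟩

@[simp] theorem x_mul (m n : Heis) : (m * n).x = m.x + n.x := rfl

@[simp] theorem y_mul (m n : Heis) : (m * n).y = m.y + n.y := rfl

@[simp] theorem z_mul (m n : Heis) : (m * n).z = m.z + n.z + m.x * n.y := rfl

@[simp] theorem x_one : (1 : Heis).x = 0 := rfl

@[simp] theorem y_one : (1 : Heis).y = 0 := rfl

@[simp] theorem z_one : (1 : Heis).z = 0 := rfl

@[simp] theorem x_inv (m : Heis) : (m⁻¹).x = -m.x := rfl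

@[simp] theorem y_inv (m : Heis) : (m⁻¹).y = -m.y := rfl

@[simp] theorem z_inv (m : Heis) : (m⁻¹).z = -m.z + m.x * m.y := rfl

instance : Group Heis :=
  Group.ofLeftAxioms
    (fun a b c => by ext <;> simp <;> ring)
    (fun a => by ext <;> simp)
    (fun a => by ext <;> simp)

/-- The matrix realization of the Heisenberg group. -/
def toMatrix (n : Heis) : Matrix (Fin 4) (Fin 4) ℝ :=
  !![1, n.x, -n.y, n.z;
     0, 1, 0, n.y;
     0, 0, 1, 0;
     0, 0, 0, 1]

theorem toMatrix_injective : Function.Injective toMatrix := by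
  intro m n h
  have h1 := congrFun (congrFun h 0) 1
  have h2 := congrFun (congrFun h 1) 3
  have h3 := congrFun (congrFun h 0) 3
  simp [toMatrix] at h1 h2 h3
  exact Heis.ext h1 h2 h3

theorem toMatrix_one : toMatrix 1 = 1 := by
  ext i j
  fin_cases i <;> fin_cases j <;> simp [toMatrix]

theorem toMatrix_mul (m n : Heis) : toMatrix (m * n) = toMatrix m * toMatrix n := by
  ext i j
  fin_cases i <;> fin_cases j <;> simp [toMatrix, Matrix.mul_apply, Fin.sum_univ_four] <;> ring

end Heis

/-- The diagonal matrix `A` with entries `ab, b, a, 1`. -/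
def dilMatrix (a b : ℝˣ) : Matrix (Fin 4) (Fin 4) ℝ :=
  Matrix.diagonal ![(a : ℝ) * b, b, a, 1]

/-- The automorphism `n ↦ A ^ m n A ^ (-m)` of the Heisenberg group in coordinates;
see `toMatrix_dil`. -/
def dil (a b : ℝˣ) (m : ℤ) (n : Heis) : Heis :=
  Heis.mk ((a : ℝ) ^ m * n.x) ((b : ℝ) ^ m * n.y) (((a : ℝ) * b) ^ m * n.z)

theorem det_dilMatrix (a b : ℝˣ) : (dilMatrix a b).det = ((a : ℝ) * b) ^ 2 := by
  simp [dilMatrix, Matrix.det_diagonal, Fin.prod_univ_four]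
  ring

theorem dilMatrix_zpow (a b : ℝˣ) (m : ℤ) :
    dilMatrix a b ^ m
      = Matrix.diagonal ![((a : ℝ) * b) ^ m, (b : ℝ) ^ m, (a : ℝ) ^ m, 1] := by
  have ha := a.ne_zero
  have hb := b.ne_zero
  have hab := mul_ne_zero ha hb
  have hu : IsUnit (dilMatrix a b).det := by
    rw [det_dilMatrix]
    exact (pow_ne_zero 2 hab).isUnit
  have key : ∀ m : ℤ, (Matrix.diagonal ![((a : ℝ) * b) ^ m, (b : ℝ) ^ m, (a : ℝ) ^ m, 1] :
      Matrix (Fin 4) (Fin 4) ℝ) * dilMatrix a b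
      = Matrix.diagonal
          ![((a : ℝ) * b) ^ (m + 1), (b : ℝ) ^ (m + 1), (a : ℝ) ^ (m + 1), 1] := by
    intro m
    rw [dilMatrix, Matrix.diagonal_mul_diagonal, zpow_add_one₀ hab, zpow_add_one₀ ha,
      zpow_add_one₀ hb]
    congr 1
    ext i
    fin_cases i <;> simp
  induction m with
  | zero =>
    ext i j
    fin_cases i <;> fin_cases j <;> simp
  | succ k ih => rw [Matrix.zpow_add_one hu, ih, key]
  | pred k ih =>
    have h := key (-(k : ℤ) - 1)
    rw [sub_add_cancel, ← ih] at h
    rw [Matrix.zpow_sub_one hu, ← h, Matrix.mul_assoc, Matrix.mul_nonsing_inv _ hu,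
      Matrix.mul_one]

/-- `dil a b m` is conjugation by the `m`-th power of `A`. -/
theorem toMatrix_dil (a b : ℝˣ) (m : ℤ) (n : Heis) :
    (dil a b m n).toMatrix = dilMatrix a b ^ m * n.toMatrix * dilMatrix a b ^ (-m) := by
  have ha := zpow_ne_zero m a.ne_zero
  have hb := zpow_ne_zero m b.ne_zero
  rw [dilMatrix_zpow, dilMatrix_zpow]
  ext i j
  fin_cases i <;> fin_cases j <;>
    simp [Heis.toMatrix, dil, Matrix.mul_apply, Fin.sum_univ_four, mul_zpow] <;> field_simp

/-! ### Invariance of the measure, needed to define the operators -/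

theorem measurePreserving_mul_left (u : Heis) : MeasurePreserving (fun n : Heis => u * n) := by
  have h1 : MeasurePreserving (fun t : ℝ => u.x + t) := measurePreserving_add_left volume u.x
  have h2 : MeasurePreserving (fun t : ℝ => u.y + t) := measurePreserving_add_left volume u.y
  have h3 : MeasurePreserving
      (fun p : ℝ × ℝ => ((u.y + p.1, u.z + p.2 + u.x * p.1) : ℝ × ℝ)) := by
    refine MeasurePreserving.skew_product (g := fun s t => u.z + t + u.x * s) h2
      (by fun_prop) (ae_of_all _ fun s => ?_)
    have : (fun t : ℝ => u.z + t + u.x * s) = fun t => (u.z + u.x * s) + t := by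
      ext t; ring
    rw [this]
    exact (measurePreserving_add_left volume (u.z + u.x * s)).map_eq
  exact h1.prod h3

theorem measurePreserving_mul_right (v : Heis) : MeasurePreserving (fun n : Heis => n * v) := by
  have h1 : MeasurePreserving (fun t : ℝ => t + v.x) := measurePreserving_add_right volume v.x
  have h2 : MeasurePreserving (fun t : ℝ => t + v.y) := measurePreserving_add_right volume v.y
  refine MeasurePreserving.skew_product
    (g := fun (s : ℝ) (p : ℝ × ℝ) => ((p.1 + v.y, p.2 + v.z + s * v.y) : ℝ × ℝ)) h1
    (by fun_prop) (ae_of_all _ fun s => ?_)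
  have h3 : MeasurePreserving (fun t : ℝ => t + (v.z + s * v.y)) :=
    measurePreserving_add_right volume _
  have h4 : (fun p : ℝ × ℝ => ((p.1 + v.y, p.2 + v.z + s * v.y) : ℝ × ℝ))
      = Prod.map (fun t => t + v.y) (fun t => t + (v.z + s * v.y)) := by
    ext p <;> simp [add_assoc]
  rw [h4]
  exact (h2.prod h3).map_eq

theorem measurable_dil (a b : ℝˣ) (m : ℤ) : Measurable (dil a b m) := by
  have h : Measurable (Prod.map (fun t : ℝ => (a : ℝ) ^ m * t)
      (Prod.map (fun t : ℝ => (b : ℝ) ^ m * t) (fun t : ℝ => ((a : ℝ) * b) ^ m * t))) := by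
    fun_prop
  exact h

theorem map_dil (a b : ℝˣ) (m : ℤ) :
    ∃ c : ℝ≥0∞, c ≠ ∞ ∧ (volume : Measure Heis).map (dil a b m) = c • volume := by
  have ha := zpow_ne_zero m a.ne_zero
  have hb := zpow_ne_zero m b.ne_zero
  have hab := zpow_ne_zero m (mul_ne_zero a.ne_zero b.ne_zero)
  have h : Measure.map (Prod.map (fun t : ℝ => (a : ℝ) ^ m * t)
      (Prod.map (fun t : ℝ => (b : ℝ) ^ m * t) (fun t : ℝ => ((a : ℝ) * b) ^ m * t)))
      ((volume : Measure ℝ).prod ((volume : Measure ℝ).prod (volume : Measure ℝ)))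
      = (ENNReal.ofReal |((a : ℝ) ^ m)⁻¹| * (ENNReal.ofReal |((b : ℝ) ^ m)⁻¹| *
        ENNReal.ofReal |(((a : ℝ) * b) ^ m)⁻¹|)) •
        ((volume : Measure ℝ).prod ((volume : Measure ℝ).prod (volume : Measure ℝ))) := by
    have h1 := Real.map_volume_mul_left ha
    have h2 := Real.map_volume_mul_left hb
    have h3 := Real.map_volume_mul_left hab
    have i1 : SFinite (Measure.map (fun t : ℝ => (b : ℝ) ^ m * t) volume) := by infer_instance
    rw [← Measure.map_prod_map _ _ (by fun_prop) (by fun_prop),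
      ← Measure.map_prod_map _ _ (by fun_prop) (by fun_prop), h1, h2, h3]
    simp only [Measure.prod_smul_left, Measure.prod_smul_right, smul_smul]
    congr 1
    ring
  exact ⟨_, by finiteness, h⟩

/-! ### The biregular representation and the dilation representation -/

/-- The space of square integrable functions on the Heisenberg group. -/
abbrev L2H : Type := Lp ℂ 2 (volume : Measure Heis)

/-- The space of square integrable functions on the real line. -/
abbrev L2R : Type := Lp ℂ 2 (volume : Measure ℝ)

/-- Left translation, `L u f n = f (u⁻¹ n)`. -/
def leftTranslation (u : Heis) (f : L2H) : L2H :=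
  Lp.compMeasurePreserving (fun n => u⁻¹ * n) (measurePreserving_mul_left u⁻¹) f

/-- Right translation, `R v f n = f (n v)`. -/
def rightTranslation (v : Heis) (f : L2H) : L2H :=
  Lp.compMeasurePreserving (fun n => n * v) (measurePreserving_mul_right v) f

/-- The biregular representation. -/
def biregular (p : Heis × Heis) (f : L2H) : L2H :=
  leftTranslation p.1 (rightTranslation p.2 f)

theorem memLp_dilation (a b : ℝˣ) (m : ℤ) (f : L2H) :
    MemLp (fun n : Heis =>
      ((|(dilMatrix a b).det| ^ (-(m : ℝ) / 2) : ℝ) : ℂ) * f (dil a b (-m) n)) 2 volume := by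
  obtain ⟨c, hc, h⟩ := map_dil a b (-m)
  have h1 : MemLp f 2 ((volume : Measure Heis).map (dil a b (-m))) := by
    rw [h]
    exact (Lp.memLp f).smul_measure hc
  exact (h1.comp_of_map (measurable_dil a b (-m)).aemeasurable).const_mul _

/-- The dilation `D_{A ^ m} f n = |det A| ^ (-m / 2) f (A ^ (-m) n A ^ m)`. The automorphism
`n ↦ A ^ m n A ^ (-m)` multiplies the Haar measure by `|det A| ^ m`. -/
def dilation (a b : ℝˣ) (m : ℤ) (f : L2H) : L2H :=
  (memLp_dilation a b m f).toLp _

/-- The discrete subset `Λ` of pairs of integer points of the Heisenberg group, the second of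
which has trivial central coordinate. -/
def Lam : Set (Heis × Heis) :=
  {p | ∃ k₁ k₂ k₃ m₂ m₃ : ℤ, p = (Heis.mk k₃ k₂ k₁, Heis.mk m₃ m₂ 0)}

/-! ### Schrödinger representations and Gabor systems -/

/-- The function `t ↦ e ^ {2 π i θ(t)} u (t - x)` is square integrable. -/
theorem memLp_phase_translate (θ : ℝ → ℝ) (hθ : Continuous θ) (s : ℝ) (u : L2R) :
    MemLp (fun t : ℝ => Complex.exp (2 * Real.pi * Complex.I * (θ t : ℂ)) * u (t - s)) 2
      volume := by
  have h : MemLp (fun t : ℝ => u (t - s)) 2 volume :=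
    (Lp.memLp u).comp_measurePreserving (measurePreserving_sub_right volume s)
  have hc : Continuous fun t : ℝ => Complex.exp (2 * Real.pi * Complex.I * (θ t : ℂ)) := by
    fun_prop
  refine h.of_le (hc.aestronglyMeasurable.mul h.aestronglyMeasurable) (ae_of_all _ fun t => ?_)
  have : (2 * Real.pi * Complex.I * (θ t : ℂ)) = ((2 * Real.pi * θ t : ℝ) : ℂ) * Complex.I := by
    push_cast; ring
  rw [norm_mul, this, Complex.norm_exp_ofReal_mul_I, one_mul]

/-- The Schrödinger representation,
`π_λ (x, y, z) u t = e ^ {2 π i λ z} e ^ {-2 π i λ y t} u (t - x)`. -/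
def schrodinger (lam : ℝ) (n : Heis) (u : L2R) : L2R :=
  (memLp_phase_translate (fun t => lam * n.z - lam * n.y * t) (by fun_prop) n.x u).toLp _

/-- The Gabor system of `u` over `α ℤ × β ℤ`: the functions
`t ↦ e ^ {2 π i (β k) t} u (t - α n)` for integers `n` and `k`. -/
def gabor (α β : ℝ) (u : L2R) (p : ℤ × ℤ) : L2R :=
  (memLp_phase_translate (fun t => β * p.2 * t) (by fun_prop) (α * p.1) u).toLp _

/-- Parseval frames of a Hilbert space. -/
def IsParsevalFrame {E : Type*} [NormedAddCommGroup E] [InnerProductSpace ℂ E] {ι : Type*}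
    (e : ι → E) : Prop :=
  ∀ h : E, HasSum (fun i => ‖inner ℂ h (e i)‖ ^ 2) (‖h‖ ^ 2)

/-! ### The Plancherel transform -/

/-- The square of the Hilbert-Schmidt norm: the sum of `‖T e_k‖ ^ 2` over an orthonormal basis
of `L²(ℝ)` (the sum does not depend on the basis). It is infinite if `T` is not a
Hilbert-Schmidt operator. -/
def hsNormSq (T : L2R →L[ℂ] L2R) : ℝ≥0∞ :=
  ∑' k, ‖T ((exists_hilbertBasis ℂ L2R).choose_spec.choose k)‖ₑ ^ 2

/-- `T` is the operator `∫ f(n) π_λ(n) dn`, in the weak sense. The inner product of Mathlib is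
linear in the second variable. -/
def IsFourierAt (f : L2H) (lam : ℝ) (T : L2R →L[ℂ] L2R) : Prop :=
  ∀ u v : L2R, inner ℂ v (T u) = ∫ n : Heis, f n * inner ℂ v (schrodinger lam n u)

/-- The field of operators `F` on the punctured line is (a representative of) the Plancherel
transform of `f`. The Plancherel transform is the extension by continuity, from the dense
subspace of integrable functions in `L²(ℍ)` to `L²(ℍ)`, of the operator-valued Fourier transform,
where the target is the direct integral of the Hilbert-Schmidt operators with respect
to the measure `|λ| dλ`. So `F` is a measurable field that is the limit, in the norm of this
direct integral, of the Fourier transforms of integrable functions that converge to `f`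
in `L²(ℍ)`. -/
def IsPlancherelTransform (f : L2H) (F : ℝ → L2R →L[ℂ] L2R) : Prop :=
  (∀ u v : L2R, AEStronglyMeasurable (fun lam => inner ℂ v (F lam u)) volume) ∧
  ∃ (g : ℕ → L2H) (G : ℕ → ℝ → L2R →L[ℂ] L2R),
    (∀ j, Integrable (g j)) ∧
    (∀ j, ∀ lam : ℝ, lam ≠ 0 → IsFourierAt (g j) lam (G j lam)) ∧
    Tendsto g atTop (𝓝 f) ∧
    Tendsto (fun j => ∫⁻ lam : ℝ, hsNormSq (G j lam - F lam) * ‖lam‖ₑ) atTop (𝓝 0)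

/-- The space `H_S` of the functions whose Plancherel transform vanishes outside `S`. -/
def bandSpace (S : Set ℝ) : Set L2H :=
  {f | ∃ F, IsPlancherelTransform f F ∧ ∀ᵐ lam : ℝ, lam ∉ S → F lam = 0}

/-! ### Congruence of sets of reals -/

/-- Translation congruence. Sets that differ by a null set are identified. -/
def TranslationCongruent (I J : Set ℝ) : Prop :=
  ∃ I' J' : Set ℝ, MeasurableSet I' ∧ MeasurableSet J' ∧
    I' =ᵐ[volume] I ∧ J' =ᵐ[volume] J ∧
    ∃ k : ℝ → ℤ, Measurable k ∧ Set.BijOn (fun t => t + k t) I' J'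

/-- Dilation congruence. Sets that differ by a null set are identified. -/
def DilationCongruent (I J : Set ℝ) : Prop :=
  ∃ I' J' : Set ℝ, MeasurableSet I' ∧ MeasurableSet J' ∧
    I' =ᵐ[volume] I ∧ J' =ᵐ[volume] J ∧
    ∃ j : ℝ → ℤ, Measurable j ∧ Set.BijOn (fun t => (2 : ℝ) ^ j t * t) I' J'

end

end HeisenbergWavelet

open HeisenbergWavelet

namespace HeisenbergWavelet

noncomputable section

/-! ### Plancherel on the line -/

/-! Write `T` for the Fourier transform of an integrable `h` at `λ`. By density of the integrable
functions (`isParsevalFrame_of_dense`) it suffices to compute the coefficients of such `h`, and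
translations and dilations are moved onto `h`, so that only integrable functions are ever translated
or dilated on the Fourier side.

For one scale, the Plancherel theorem gives `⟨h, τ(γ,η)f⟩ = ∫_S ⟨T π_λ(η) v_λ, π_λ(γ) u_λ⟩ |λ| dλ`
(`exists_integrable_inner_biregular`). The central coordinate `k₁` of `γ` enters only through the
factor `e^{2πiλk₁}`. Since `S` tiles the line by integer translations, these exponentials form a
Parseval frame of `L²(S)`, and the sum over `k₁` is the integral over `S` of the squared modulus
(`tsum_enorm_setIntegral_exp_sq`). The other four integers run through the Gabor systems of `u_λ`
and `v_λ`. Each system, scaled by `|λ|^{1/4}`, is Parseval, so both sums together contribute `|λ|⁻¹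
‖T‖²_HS`; with the factor `|λ|²` this leaves `|λ| ‖T‖²_HS`, the Plancherel density of `h`
(`tsum_tsum_enorm_inner_gabor`). Hence one scale yields the integral of this density over `S`
(`tsum_enorm_inner_biregular`).

The dilation `D_{A^m}` acts on the density through `λ ↦ 2^m λ`, so the scale `m` yields the integral
over `2^{-m} S`. These sets tile the line, and the sum over `m` is `‖h‖²`.

The Plancherel theorem itself is reduced to the line. The Fourier transform in the centre turns `T`
into a Weyl transform, which has an explicit integral kernel; its Hilbert–Schmidt norm is the `L²`
norm of the kernel (`enorm_mul_hsNormSq_weyl`). -/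

open FourierTransform SchwartzMap in
/-- The `L²` Fourier transform agrees with the Fourier integral on `L¹ ∩ L²`. -/
theorem fourier_toLp_ae_eq {f : ℝ → ℂ} (h1 : Integrable f) (h2 : MemLp f 2) :
    ((𝓕 (h2.toLp f) : Lp ℂ 2 (volume : Measure ℝ)) : ℝ → ℂ) =ᵐ[volume] 𝓕 f := by
  have hc : Continuous (𝓕 f) :=
    VectorFourier.fourierIntegral_continuous Real.continuous_fourierChar
      (by exact continuous_inner) h1
  -- Both sides are tested against smooth compactly supported `g`. Both pairings equal the integral
  -- of `f` against `𝓕 g`: one by the definition of the distributional Fourier transform, the other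
  -- by self-adjointness of the Fourier integral.
  refine ae_eq_of_integral_contDiff_smul_eq
    ((Lp.memLp _).locallyIntegrable (by norm_num)) hc.locallyIntegrable fun g hg hgc => ?_
  have hg₁ : HasCompactSupport (Complex.ofRealCLM ∘ g) := hgc.comp_left rfl
  have hg₂ : ContDiff ℝ ((⊤ : ℕ∞) : WithTop ℕ∞) (Complex.ofRealCLM ∘ g) := by fun_prop
  set G : 𝓢(ℝ, ℂ) := hg₁.toSchwartzMap hg₂
  have hG : ∀ x, G x = (g x : ℂ) := fun x => rfl
  have e1 : ∫ x, g x • ((𝓕 (h2.toLp f) : Lp ℂ 2 (volume : Measure ℝ)) : ℝ → ℂ) x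
      = Lp.toTemperedDistribution (𝓕 (h2.toLp f)) G := by
    rw [Lp.toTemperedDistribution_apply]
    simp [hG]
  have e2 : Lp.toTemperedDistribution (h2.toLp f) (𝓕 G) = ∫ x, (𝓕 (G : ℝ → ℂ)) x • f x := by
    rw [Lp.toTemperedDistribution_apply]
    refine integral_congr_ae ?_
    filter_upwards [h2.coeFn_toLp] with x hx
    rw [hx, SchwartzMap.fourier_coe]
  rw [e1, ← Lp.fourier_toTemperedDistribution_eq, TemperedDistribution.fourier_apply, e2]
  have := VectorFourier.integral_fourierIntegral_smul_eq_flip (L := innerₗ ℝ) (μ := volume)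
    (ν := volume) Real.continuous_fourierChar (by exact continuous_inner) G.integrable h1
  rw [flip_innerₗ] at this
  exact this

theorem lintegral_enorm_sq_L2 {α : Type*} [MeasurableSpace α] {μ : Measure α} (g : Lp ℂ 2 μ) :
    ∫⁻ x, ‖g x‖ₑ ^ 2 ∂μ = ‖g‖ₑ ^ 2 := by
  rw [Lp.enorm_def, eLpNorm_eq_lintegral_rpow_enorm_toReal (by norm_num) (by norm_num),
    ← ENNReal.rpow_natCast, ← ENNReal.rpow_mul]
  norm_num

open FourierTransform in
/-- Plancherel's theorem on `L¹ ∩ L²`. -/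
theorem lintegral_enorm_fourier_sq {f : ℝ → ℂ} (h1 : Integrable f) (h2 : MemLp f 2) :
    ∫⁻ w, ‖𝓕 f w‖ₑ ^ 2 = ∫⁻ x, ‖f x‖ₑ ^ 2 := by
  calc ∫⁻ w, ‖𝓕 f w‖ₑ ^ 2
      = ∫⁻ w, ‖((𝓕 (h2.toLp f) : Lp ℂ 2 (volume : Measure ℝ)) : ℝ → ℂ) w‖ₑ ^ 2 :=
        lintegral_congr_ae ((fourier_toLp_ae_eq h1 h2).mono fun w hw => by simp only [hw])
    _ = ‖h2.toLp f‖ₑ ^ 2 := by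
        rw [lintegral_enorm_sq_L2, ← ofReal_norm, Lp.norm_fourier_eq, ofReal_norm]
    _ = ∫⁻ x, ‖f x‖ₑ ^ 2 := by
        rw [← lintegral_enorm_sq_L2]
        exact lintegral_congr_ae (h2.coeFn_toLp.mono fun w hw => by simp only [hw])

theorem fourier_eq_integral_exp (f : ℝ → ℂ) (w : ℝ) : FourierTransform.fourier f w
    = ∫ x, Complex.exp (2 * Real.pi * Complex.I * ((-(w * x) : ℝ) : ℂ)) * f x := by
  rw [Real.fourier_real_eq_integral_exp_smul]
  refine integral_congr_ae (ae_of_all _ fun x => ?_)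
  simp only [smul_eq_mul]
  congr 2
  push_cast; ring

/-! ### Tilings -/

/-- A set that is congruent to a tile for a quasi measure preserving action of `ℤ` is a tile. -/
theorem ae_existsUnique_mem_of_congruent {T : ℤ → ℝ → ℝ}
    (hadd : ∀ m n x, T (m + n) x = T m (T n x)) (hzero : ∀ x, T 0 x = x)
    (hq : ∀ n, Measure.QuasiMeasurePreserving (T n)) {I J I' J' : Set ℝ}
    (hI : I' =ᵐ[volume] I) (hJ : J' =ᵐ[volume] J) {k : ℝ → ℤ}
    (hk : Set.BijOn (fun t => T (k t) t) I' J') (htile : ∀ᵐ x : ℝ, ∃! n, T n x ∈ J) :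
    ∀ᵐ x : ℝ, ∃! n, T n x ∈ I := by
  have hI2 : ∀ᵐ x : ℝ, ∀ n, (T n x ∈ I' ↔ T n x ∈ I) :=
    ae_all_iff.2 fun n => (hq n).ae (hI.mem_iff)
  have hJ2 : ∀ᵐ x : ℝ, ∀ n, (T n x ∈ J' ↔ T n x ∈ J) :=
    ae_all_iff.2 fun n => (hq n).ae (hJ.mem_iff)
  filter_upwards [hI2, hJ2, htile] with x h1 h2 ⟨n, hn, hu⟩
  -- `t` is the point of `I'` that the congruence carries to the representative of the orbit of `x`
  -- in `J'`. Hence `t` lies in the orbit of `x`, reached by the exponent `-k t + n`.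
  obtain ⟨t, ht, hte⟩ := hk.surjOn ((h2 n).2 hn)
  have hkey : ∀ m, T m x ∈ I → k (T m x) + m = n := by
    intro m hm
    have := hk.mapsTo ((h1 m).2 hm)
    simp only [← hadd] at this
    exact hu _ ((h2 _).1 this)
  have hT : T (-k t + n) x = t := by
    rw [hadd, ← hte, ← hadd, neg_add_cancel, hzero]
  refine ⟨-k t + n, (h1 _).1 (by rw [hT]; exact ht), fun m hm => ?_⟩
  have e1 := hkey m hm
  have : T m x = t := by
    refine hk.injOn ((h1 m).2 hm) ht ?_
    simp only [← hadd] at hte ⊢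
    rw [e1, hte]
  rw [this] at e1
  linarith

theorem TranslationCongruent.ae_existsUnique {S : Set ℝ}
    (h : TranslationCongruent S (Set.Ioc 0 1)) : ∀ᵐ x : ℝ, ∃! n : ℤ, x + n ∈ S := by
  obtain ⟨I', J', -, -, hI, hJ, k, -, hk⟩ := h
  refine ae_existsUnique_mem_of_congruent (T := fun n x => x + n) (fun m n x => by push_cast; ring)
    (by simp) (fun n => (measurePreserving_add_right volume _).quasiMeasurePreserving) hI hJ hk
    (ae_of_all _ fun x => ?_)
  simpa using existsUnique_add_zsmul_mem_Ioc one_pos x 0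

theorem quasiMeasurePreserving_const_mul {c : ℝ} (hc : c ≠ 0) :
    Measure.QuasiMeasurePreserving (fun x : ℝ => c * x) := by
  refine ⟨measurable_const_mul c, ?_⟩
  rw [Real.map_volume_mul_left hc]
  exact Measure.smul_absolutelyContinuous

theorem DilationCongruent.ae_existsUnique {S : Set ℝ}
    (h : DilationCongruent S (Set.Ico (-1) (-1 / 2) ∪ Set.Ioc (1 / 2) 1)) :
    ∀ᵐ x : ℝ, ∃! n : ℤ, (2 : ℝ) ^ n * x ∈ S := by
  obtain ⟨I', J', -, -, hI, hJ, k, -, hk⟩ := h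
  refine ae_existsUnique_mem_of_congruent (T := fun n x => (2 : ℝ) ^ n * x)
    (fun m n x => by rw [zpow_add₀ two_ne_zero, mul_assoc])
    (by simp) (fun n => quasiMeasurePreserving_const_mul (zpow_ne_zero _ two_ne_zero)) hI hJ hk ?_
  have h0 : ∀ᵐ x : ℝ, x ≠ 0 := by simp [ae_iff]
  filter_upwards [h0] with x hx
  have hmem : ∀ n : ℤ, (2 : ℝ) ^ n * x ∈ Set.Ico (-1 : ℝ) (-1 / 2) ∪ Set.Ioc (1 / 2) 1 ↔
      1 / 2 < (2 : ℝ) ^ n * |x| ∧ (2 : ℝ) ^ n * |x| ≤ 1 := by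
    intro n
    have hp : (0 : ℝ) < 2 ^ n := zpow_pos two_pos n
    rw [← abs_of_pos hp, ← abs_mul, abs_of_pos hp]
    simp only [Set.mem_union, Set.mem_Ico, Set.mem_Ioc]
    rcases abs_cases ((2 : ℝ) ^ n * x) with ⟨h1, h2⟩ | ⟨h1, h2⟩ <;> rw [h1] <;> constructor
    · rintro (h | h) <;> constructor <;> linarith [h.1, h.2]
    · intro h; right; exact h
    · rintro (h | h) <;> constructor <;> linarith [h.1, h.2]
    · intro h; left; constructor <;> linarith [h.1, h.2]
  simp only [hmem]
  have hx' : 0 < |x|⁻¹ := inv_pos.2 (abs_pos.2 hx)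
  -- The condition `1/2 < 2^n |x| ≤ 1` reads `2^n ≤ |x|⁻¹ < 2^(n+1)`, which fixes `n`.
  obtain ⟨n, hn, hn'⟩ := exists_mem_Ico_zpow hx' (one_lt_two : (1 : ℝ) < 2)
  have hax := abs_pos.2 hx
  refine ⟨n, ⟨?_, ?_⟩, fun m hm => ?_⟩
  · rw [zpow_add_one₀ two_ne_zero, inv_lt_iff_one_lt_mul₀ hax] at hn'
    linarith
  · rw [le_inv_comm₀ (zpow_pos two_pos n) hax, ← one_div, le_div_iff₀ (zpow_pos two_pos n)] at hn
    linarith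
  · have a1 : (2 : ℝ) ^ m ≤ |x|⁻¹ := by
      rw [← one_div, le_div_iff₀ hax]; exact hm.2
    have a2 : |x|⁻¹ < (2 : ℝ) ^ (m + 1) := by
      rw [zpow_add_one₀ two_ne_zero, inv_lt_iff_one_lt_mul₀ hax]
      linarith [hm.1]
    have b1 := (zpow_lt_zpow_iff_right₀ (one_lt_two : (1 : ℝ) < 2)).1 (a1.trans_lt hn')
    have b2 := (zpow_lt_zpow_iff_right₀ (one_lt_two : (1 : ℝ) < 2)).1 (hn.trans_lt a2)
    omega

/-! ### Fourier series on a tile -/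

/-- The exponentials with integer frequencies are a Parseval frame for the square integrable
functions on a set that tiles the line by integer translations. -/
theorem tsum_enorm_setIntegral_exp_sq {S : Set ℝ} (hS : MeasurableSet S)
    (htile : ∀ᵐ x : ℝ, ∃! n : ℤ, x + n ∈ S) {φ : ℝ → ℂ}
    (hφ : MemLp φ 2 (volume.restrict S)) :
    ∑' k : ℤ, ‖∫ t in S, Complex.exp (2 * Real.pi * Complex.I * ((t * k : ℝ) : ℂ)) * φ t‖ₑ ^ 2
      = ∫⁻ t in S, ‖φ t‖ₑ ^ 2 := by
  have hshift : ∀ n : ℤ, Measure.QuasiMeasurePreserving (fun x : ℝ => x + n) := fun n =>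
    (measurePreserving_add_right volume _).quasiMeasurePreserving
  have hmem : ∀ (g : AddSubgroup.zmultiples (1 : ℝ)), ∃ n : ℤ, (g : ℝ) = n := by
    rintro ⟨g, n, rfl⟩; exact ⟨n, by simp⟩
  have hS' : IsAddFundamentalDomain (AddSubgroup.zmultiples (1 : ℝ)) S := by
    refine IsAddFundamentalDomain.mk'' hS.nullMeasurableSet ?_ ?_ ?_
    · filter_upwards [htile] with x ⟨n, hn, _⟩
      refine ⟨⟨n, n, by simp⟩, ?_⟩
      rw [AddSubgroup.vadd_def, vadd_eq_add, add_comm]; exact hn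
    · intro g hg
      obtain ⟨n, hn⟩ := hmem g
      have hn0 : n ≠ 0 := by
        rintro rfl; apply hg; ext; simpa using hn
      refine measure_mono_null (fun x hx => ?_) (ae_iff.1 htile)
      rw [Set.mem_ofPred_eq]
      intro hu
      obtain ⟨y, hy, hyx⟩ := hx.1
      simp only [AddSubgroup.vadd_def, vadd_eq_add, hn] at hyx
      have := hu.unique (y₁ := 0) (y₂ := -n) (by simpa using hx.2) (by simpa [← hyx] using hy)
      omega
    · intro g
      obtain ⟨n, hn⟩ := hmem g
      simpa [AddSubgroup.vadd_def, hn, add_comm] using hshift n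
  have hI : IsAddFundamentalDomain (AddSubgroup.zmultiples (1 : ℝ)) (Set.Ioc (0 : ℝ) 1) := by
    simpa using isAddFundamentalDomain_Ioc one_pos (0 : ℝ)
  -- The 1-periodic function that agrees with `φ` almost everywhere on `S`. Integrals of periodic
  -- functions over the fundamental domains `S` and `(0, 1]` coincide, so classical Fourier series
  -- on `(0, 1]` apply to it.
  set ψ : ℝ → ℂ := fun x => ∑' n : ℤ, S.indicator φ (x + n) with hψdef
  have hψinv : ∀ (n : ℤ) (x : ℝ), ψ (n + x) = ψ x := by
    intro n x
    simp only [hψdef]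
    rw [← (Equiv.addLeft n).tsum_eq (fun m : ℤ => S.indicator φ (x + m))]
    refine tsum_congr fun m => ?_
    congr 1; simp; ring
  have hψS : ∀ᵐ x ∂(volume.restrict S), ψ x = φ x := by
    rw [ae_restrict_iff' hS]
    filter_upwards [htile] with x hu hx
    simp only [hψdef]
    rw [tsum_eq_single 0]
    · simp [hx]
    · intro n hn
      refine Set.indicator_of_notMem (fun h => hn ?_) _
      exact hu.unique h (by simpa using hx)
  have hexp : ∀ (k n : ℤ) (x : ℝ), Complex.exp (2 * Real.pi * Complex.I * (((n + x) * k : ℝ) : ℂ))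
      = Complex.exp (2 * Real.pi * Complex.I * ((x * k : ℝ) : ℂ)) := by
    intro k n x
    rw [← Complex.exp_periodic.int_mul (n * k) (2 * Real.pi * Complex.I * ((x * k : ℝ) : ℂ))]
    congr 1; push_cast; ring
  have hψm : MemLp ψ 2 (volume.restrict (Set.Ioc (0 : ℝ) 1)) := by
    have h1 : MemLp ψ 2 (volume.restrict S) := (memLp_congr_ae hψS).2 hφ
    refine ⟨(hS'.aestronglyMeasurable_on_iff hI fun g x => ?_).1 h1.1, ?_⟩
    · obtain ⟨n, hn⟩ := hmem g
      rw [AddSubgroup.vadd_def, vadd_eq_add, hn, hψinv]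
    · have h2 := h1.2
      rw [eLpNorm_lt_top_iff_lintegral_rpow_enorm_lt_top (by norm_num) (by norm_num)] at h2 ⊢
      rwa [hS'.setLIntegral_eq hI] at h2
      intro g x
      obtain ⟨n, hn⟩ := hmem g
      rw [AddSubgroup.vadd_def, vadd_eq_add, hn, hψinv]
  have hcoef : ∀ k : ℤ, ∫ t in S, Complex.exp (2 * Real.pi * Complex.I * ((t * k : ℝ) : ℂ)) * φ t
      = fourierCoeffOn (zero_lt_one' ℝ) ψ (-k) := by
    intro k
    calc _ = ∫ t in S, Complex.exp (2 * Real.pi * Complex.I * ((t * k : ℝ) : ℂ)) * ψ t :=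
          integral_congr_ae (hψS.mono fun x hx => by simp only [hx])
      _ = ∫ t in Set.Ioc (0 : ℝ) 1,
            Complex.exp (2 * Real.pi * Complex.I * ((t * k : ℝ) : ℂ)) * ψ t := by
          refine hS'.setIntegral_eq hI fun g x => ?_
          obtain ⟨n, hn⟩ := hmem g
          rw [AddSubgroup.vadd_def, vadd_eq_add, hn, hψinv, hexp]
      _ = _ := by
          rw [fourierCoeffOn_eq_integral, intervalIntegral.integral_of_le zero_le_one]
          simp only [sub_zero, div_one, one_smul, neg_neg, smul_eq_mul, fourier_coe_apply]
          refine integral_congr_ae (ae_of_all _ fun t => ?_)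
          simp only
          congr 2; push_cast; ring
  have hsum := hasSum_sq_fourierCoeffOn (zero_lt_one' ℝ) hψm
  rw [intervalIntegral.integral_of_le zero_le_one, sub_zero, inv_one, one_smul] at hsum
  have hint : Integrable (fun x => ‖ψ x‖ ^ 2) (volume.restrict (Set.Ioc (0 : ℝ) 1)) :=
    hψm.integrable_norm_pow (by norm_num)
  calc _ = ∑' k : ℤ, ENNReal.ofReal (‖fourierCoeffOn (zero_lt_one' ℝ) ψ k‖ ^ 2) := by
        rw [← (Equiv.neg ℤ).tsum_eq]
        refine tsum_congr fun k => ?_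
        rw [hcoef, ENNReal.ofReal_pow (norm_nonneg _), ofReal_norm]
        simp
    _ = ENNReal.ofReal (∫ x in Set.Ioc (0 : ℝ) 1, ‖ψ x‖ ^ 2) := by
        rw [← ENNReal.ofReal_tsum_of_nonneg (fun _ => by positivity) hsum.summable, hsum.tsum_eq]
    _ = ∫⁻ x in Set.Ioc (0 : ℝ) 1, ‖ψ x‖ₑ ^ 2 := by
        rw [ofReal_integral_eq_lintegral_ofReal hint (ae_of_all _ fun _ => by positivity)]
        simp [ENNReal.ofReal_pow, ofReal_norm]
    _ = ∫⁻ x in S, ‖ψ x‖ₑ ^ 2 := by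
        refine hI.setLIntegral_eq hS' _ fun g x => ?_
        obtain ⟨n, hn⟩ := hmem g
        rw [AddSubgroup.vadd_def, vadd_eq_add, hn, hψinv]
    _ = _ := lintegral_congr_ae (hψS.mono fun x hx => by simp only [hx])

/-! ### Hilbert-Schmidt norms -/

/-- Orthonormal vectors are `√2` apart, so the balls of radius `1/2` around them are disjoint, and a
separable space has room for only countably many. Countability of the basis is what lets almost
everywhere statements and integrals pass through sums over it. -/
theorem countable_of_orthonormal {E ι : Type*} [NormedAddCommGroup E] [InnerProductSpace ℂ E]
    [TopologicalSpace.SeparableSpace E] {e : ι → E} (he : Orthonormal ℂ e) : Countable ι := by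
  refine Pairwise.countable_of_isOpen_disjoint (s := fun i => Metric.ball (e i) (1 / 2))
    (fun i j hij => ?_) (fun _ => Metric.isOpen_ball)
    (fun i => ⟨e i, Metric.mem_ball_self (by norm_num)⟩)
  refine Metric.ball_disjoint_ball ?_
  have h : ‖e i - e j‖ ^ 2 = 2 := by
    rw [@norm_sub_sq ℂ, he.2 hij, he.1, he.1]
    norm_num
  rw [dist_eq_norm]
  nlinarith [norm_nonneg (e i - e j)]

/-- The index set of the orthonormal basis in `hsNormSq`. -/
abbrev HSIndex : Type := (exists_hilbertBasis ℂ L2R).choose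

/-- The orthonormal basis in `hsNormSq`. -/
def hsBasis : HilbertBasis HSIndex ℂ L2R := (exists_hilbertBasis ℂ L2R).choose_spec.choose

instance : Countable HSIndex :=
  haveI : Fact ((2 : ℝ≥0∞) ≠ ∞) := ⟨ENNReal.ofNat_ne_top⟩
  countable_of_orthonormal hsBasis.orthonormal

theorem hsNormSq_eq (T : L2R →L[ℂ] L2R) : hsNormSq T = ∑' k, ‖T (hsBasis k)‖ₑ ^ 2 := rfl

theorem IsParsevalFrame.tsum_enorm {E ι : Type*} [NormedAddCommGroup E] [InnerProductSpace ℂ E]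
    {e : ι → E} (he : IsParsevalFrame e) (h : E) :
    ∑' i, ‖inner ℂ h (e i)‖ₑ ^ 2 = ‖h‖ₑ ^ 2 := by
  have := ENNReal.ofReal_tsum_of_nonneg (fun i => by positivity) (he h).summable
  rw [(he h).tsum_eq] at this
  simpa [ENNReal.ofReal_pow] using this.symm

theorem isParsevalFrame_of_tsum_enorm {E ι : Type*} [NormedAddCommGroup E] [InnerProductSpace ℂ E]
    {e : ι → E} (he : ∀ h, ∑' i, ‖inner ℂ h (e i)‖ₑ ^ 2 = ‖h‖ₑ ^ 2) : IsParsevalFrame e := by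
  intro h
  have h1 : ∀ i, ‖inner ℂ h (e i)‖ₑ ^ 2 = ENNReal.ofReal (‖inner ℂ h (e i)‖ ^ 2) := fun i => by
    simp [ENNReal.ofReal_pow]
  have h2 := he h
  simp only [h1] at h2
  have hne : ∑' i, ENNReal.ofReal (‖inner ℂ h (e i)‖ ^ 2) ≠ ∞ := by
    rw [h2]; finiteness
  have h3 := ENNReal.hasSum_toReal hne
  rw [← ENNReal.tsum_toReal_eq (fun _ => ENNReal.ofReal_ne_top), h2] at h3
  simpa [ENNReal.toReal_ofReal] using h3

theorem isParsevalFrame_hilbertBasis {E ι : Type*} [NormedAddCommGroup E] [InnerProductSpace ℂ E]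
    (b : HilbertBasis ι ℂ E) : IsParsevalFrame b := by
  intro h
  have h1 := b.hasSum_inner_mul_inner h h
  have h2 := Complex.hasSum_re h1
  convert! h2 using 1
  · ext i
    rw [← inner_conj_symm (b i) h, RCLike.mul_conj]
    norm_cast
  · rw [@inner_self_eq_norm_sq_to_K ℂ]; norm_cast

theorem tsum_enorm_inner_hsBasis (w : L2R) : ∑' k, ‖inner ℂ w (hsBasis k)‖ₑ ^ 2 = ‖w‖ₑ ^ 2 :=
  (isParsevalFrame_hilbertBasis hsBasis).tsum_enorm w

theorem enorm_inner_symm {E : Type*} [NormedAddCommGroup E] [InnerProductSpace ℂ E] (x y : E) :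
    ‖inner ℂ x y‖ₑ = ‖inner ℂ y x‖ₑ := by
  rw [← ofReal_norm, ← ofReal_norm, norm_inner_symm]

theorem tsum_enorm_inner_hsBasis' (w : L2R) : ∑' k, ‖inner ℂ (hsBasis k) w‖ₑ ^ 2 = ‖w‖ₑ ^ 2 := by
  simp only [enorm_inner_symm _ w, tsum_enorm_inner_hsBasis]

theorem hsNormSq_eq_tsum_tsum (T : L2R →L[ℂ] L2R) :
    hsNormSq T = ∑' k, ∑' l, ‖inner ℂ (hsBasis l) (T (hsBasis k))‖ₑ ^ 2 := by
  simp only [tsum_enorm_inner_hsBasis', hsNormSq_eq]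

/-- The Hilbert-Schmidt norm can be computed with any Parseval frame. -/
theorem tsum_enorm_apply_sq {ι : Type*} {x : ι → L2R}
    (hx : ∀ w, ∑' i, ‖inner ℂ w (x i)‖ₑ ^ 2 = ‖w‖ₑ ^ 2) (T : L2R →L[ℂ] L2R) :
    ∑' i, ‖T (x i)‖ₑ ^ 2 = hsNormSq T := by
  -- Expanding `T (x i)` in the orthonormal basis and exchanging the sums leaves the frame
  -- coefficients of `T* e_k`, to which only the Parseval identity is applied.
  calc ∑' i, ‖T (x i)‖ₑ ^ 2
      = ∑' i, ∑' k, ‖inner ℂ (T.adjoint (hsBasis k)) (x i)‖ₑ ^ 2 := by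
        simp only [ContinuousLinearMap.adjoint_inner_left, tsum_enorm_inner_hsBasis']
    _ = ∑' k, ‖T.adjoint (hsBasis k)‖ₑ ^ 2 := by
        rw [ENNReal.tsum_comm]
        simp only [hx]
    _ = ∑' k, ∑' l, ‖inner ℂ (T.adjoint (hsBasis k)) (hsBasis l)‖ₑ ^ 2 := by
        simp only [tsum_enorm_inner_hsBasis]
    _ = hsNormSq T := by
        rw [ENNReal.tsum_comm, hsNormSq_eq_tsum_tsum]
        simp only [ContinuousLinearMap.adjoint_inner_left]

theorem hsNormSq_smul (c : ℂ) (T : L2R →L[ℂ] L2R) :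
    hsNormSq (c • T) = ‖c‖ₑ ^ 2 * hsNormSq T := by
  simp only [hsNormSq_eq, smul_apply, enorm_smul, mul_pow, ENNReal.tsum_mul_left]

theorem hsNormSq_neg (T : L2R →L[ℂ] L2R) : hsNormSq (-T) = hsNormSq T := by
  simp [hsNormSq_eq]

theorem hsNormSq_sub_comm (S T : L2R →L[ℂ] L2R) : hsNormSq (S - T) = hsNormSq (T - S) := by
  rw [← hsNormSq_neg, neg_sub]

theorem eq_zero_of_hsNormSq_eq_zero {T : L2R →L[ℂ] L2R} (h : hsNormSq T = 0) : T = 0 := by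
  rw [hsNormSq_eq, ENNReal.tsum_eq_zero] at h
  refine ContinuousLinearMap.ext_on
    (Submodule.dense_iff_topologicalClosure_eq_top.2 hsBasis.dense_span) ?_
  rintro _ ⟨k, rfl⟩
  simpa using h k

/-- Minkowski's inequality for square summable families. -/
theorem sqrt_tsum_enorm_add_sq_le {E ι : Type*} [NormedAddCommGroup E] (x y : ι → E) :
    (∑' i, ‖x i + y i‖ₑ ^ 2) ^ (1 / 2 : ℝ)
      ≤ (∑' i, ‖x i‖ₑ ^ 2) ^ (1 / 2 : ℝ) + (∑' i, ‖y i‖ₑ ^ 2) ^ (1 / 2 : ℝ) := by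
  let _ : MeasurableSpace ι := ⊤
  have h := ENNReal.lintegral_Lp_add_le (μ := (Measure.count : Measure ι)) (p := 2)
    (f := fun k => ‖x k‖ₑ) (g := fun k => ‖y k‖ₑ)
    (measurable_from_top).aemeasurable (measurable_from_top).aemeasurable one_le_two
  simp only [lintegral_count, ENNReal.rpow_ofNat] at h
  refine le_trans ?_ h
  refine ENNReal.rpow_le_rpow (ENNReal.tsum_le_tsum fun k => ?_) (by norm_num)
  gcongr
  exact enorm_add_le _ _

theorem sqrt_hsNormSq_add_le (S T : L2R →L[ℂ] L2R) :
    hsNormSq (S + T) ^ (1 / 2 : ℝ) ≤ hsNormSq S ^ (1 / 2 : ℝ) + hsNormSq T ^ (1 / 2 : ℝ) :=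
  sqrt_tsum_enorm_add_sq_le (fun k => S (hsBasis k)) (fun k => T (hsBasis k))

/-- Cruder than Minkowski, but linear in the squared norms, so that it can be integrated in `λ`
directly. -/
theorem hsNormSq_add_le (S T : L2R →L[ℂ] L2R) :
    hsNormSq (S + T) ≤ 2 * (hsNormSq S + hsNormSq T) := by
  simp only [hsNormSq_eq]
  rw [← ENNReal.tsum_add, ← ENNReal.tsum_mul_left]
  refine ENNReal.tsum_le_tsum fun k => ?_
  calc ‖(S + T) (hsBasis k)‖ₑ ^ 2 ≤ (‖S (hsBasis k)‖ₑ + ‖T (hsBasis k)‖ₑ) ^ 2 := by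
        gcongr; exact enorm_add_le _ _
    _ ≤ _ := by
        have := ENNReal.rpow_add_le_mul_rpow_add_rpow (‖S (hsBasis k)‖ₑ) (‖T (hsBasis k)‖ₑ)
          (p := 2) one_le_two
        norm_num at this
        exact this

/-- Weak measurability of a field of operators. -/
def WeaklyMeasurable (F : ℝ → L2R →L[ℂ] L2R) : Prop :=
  ∀ u v : L2R, AEStronglyMeasurable (fun lam => inner ℂ v (F lam u)) volume

/-- The squared norm is a countable double sum of squared matrix coefficients, each of which is
measurable. -/
theorem WeaklyMeasurable.aemeasurable_hsNormSq {F : ℝ → L2R →L[ℂ] L2R} (hF : WeaklyMeasurable F) :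
    AEMeasurable (fun lam => hsNormSq (F lam)) := by
  simp only [hsNormSq_eq_tsum_tsum]
  exact AEMeasurable.tsum fun k => AEMeasurable.tsum fun l =>
    (hF _ _).enorm.pow_const 2

theorem WeaklyMeasurable.add {F G : ℝ → L2R →L[ℂ] L2R} (hF : WeaklyMeasurable F)
    (hG : WeaklyMeasurable G) : WeaklyMeasurable (F + G) := fun u v => by
  simpa [inner_add_right] using! (hF u v).add (hG u v)

theorem WeaklyMeasurable.smul {F : ℝ → L2R →L[ℂ] L2R} (hF : WeaklyMeasurable F) (c : ℂ) :
    WeaklyMeasurable (c • F) := fun u v => by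
  simpa [inner_smul_right] using! (hF u v).const_mul c

/-- The Hilbert-Schmidt inner product, through polarization. -/
def hsInner (S T : L2R →L[ℂ] L2R) : ℂ :=
  (((hsNormSq (S + T)).toReal : ℂ) - ((hsNormSq (S - T)).toReal : ℂ)
    + (((hsNormSq (S - Complex.I • T)).toReal : ℂ)
      - ((hsNormSq (S + Complex.I • T)).toReal : ℂ)) * Complex.I) / 4

theorem hasSum_norm_apply_sq {T : L2R →L[ℂ] L2R} (hT : hsNormSq T ≠ ∞) :
    HasSum (fun k => (((‖T (hsBasis k)‖ : ℝ) : ℂ)) ^ 2) ((hsNormSq T).toReal : ℂ) := by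
  rw [hsNormSq_eq] at hT ⊢
  have h := ENNReal.hasSum_toReal hT
  rw [← ENNReal.tsum_toReal_eq (fun _ => by finiteness)] at h
  simp only [ENNReal.toReal_pow, toReal_enorm] at h
  exact_mod_cast Complex.hasSum_ofReal.2 h

theorem hsNormSq_add_smul_ne_top {S T : L2R →L[ℂ] L2R} (hS : hsNormSq S ≠ ∞) (hT : hsNormSq T ≠ ∞)
    (c : ℂ) : hsNormSq (S + c • T) ≠ ∞ := by
  refine ne_top_of_le_ne_top ?_ (hsNormSq_add_le _ _)
  rw [hsNormSq_smul]
  finiteness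

/-- Polarization at each basis vector, then summation. Finiteness matters because `toReal` sends `∞`
to `0`. -/
theorem hasSum_hsInner {S T : L2R →L[ℂ] L2R} (hS : hsNormSq S ≠ ∞) (hT : hsNormSq T ≠ ∞) :
    HasSum (fun k => inner ℂ (S (hsBasis k)) (T (hsBasis k))) (hsInner S T) := by
  have h1 := hasSum_norm_apply_sq (hsNormSq_add_smul_ne_top hS hT 1)
  have h2 := hasSum_norm_apply_sq (hsNormSq_add_smul_ne_top hS hT (-1))
  have h3 := hasSum_norm_apply_sq (hsNormSq_add_smul_ne_top hS hT (-Complex.I))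
  have h4 := hasSum_norm_apply_sq (hsNormSq_add_smul_ne_top hS hT Complex.I)
  have h := ((h1.sub h2).add ((h3.sub h4).mul_right Complex.I)).div_const 4
  simp only [one_smul, neg_smul, ← sub_eq_add_neg] at h
  convert! h using 1
  ext k
  rw [inner_eq_sum_norm_sq_div_four]
  rfl

theorem hsNormSq_rankOne (u v : L2R) :
    hsNormSq (InnerProductSpace.rankOne ℂ u v) = ‖v‖ₑ ^ 2 * ‖u‖ₑ ^ 2 := by
  simp only [hsNormSq_eq, InnerProductSpace.rankOne_apply, enorm_smul, mul_pow,
    ENNReal.tsum_mul_right, tsum_enorm_inner_hsBasis]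

/-- The series for the left side is `∑ ⟨v, e_k⟩⟨e_k, T* u⟩`, which is `⟨v, T* u⟩` by Parseval. -/
theorem hsInner_rankOne {T : L2R →L[ℂ] L2R} (hT : hsNormSq T ≠ ∞) (u v : L2R) :
    hsInner T (InnerProductSpace.rankOne ℂ u v) = inner ℂ (T v) u := by
  have hR : hsNormSq (InnerProductSpace.rankOne ℂ u v) ≠ ∞ := by
    rw [hsNormSq_rankOne]; finiteness
  refine (hasSum_hsInner hT hR).unique ?_
  have h := hsBasis.hasSum_inner_mul_inner v (T.adjoint u)
  simp only [ContinuousLinearMap.adjoint_inner_right] at h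
  simpa [inner_smul_right] using h

theorem hsInner_zero_right (T : L2R →L[ℂ] L2R) : hsInner T 0 = 0 := by simp [hsInner]

/-! ### Schrödinger representations -/

theorem norm_phase (r : ℝ) : ‖Complex.exp (2 * Real.pi * Complex.I * (r : ℂ))‖ = 1 := by
  have : (2 * Real.pi * Complex.I * (r : ℂ)) = ((2 * Real.pi * r : ℝ) : ℂ) * Complex.I := by
    push_cast; ring
  rw [this, Complex.norm_exp_ofReal_mul_I]

theorem enorm_phase (r : ℝ) : ‖Complex.exp (2 * Real.pi * Complex.I * (r : ℂ))‖ₑ = 1 := by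
  rw [← ofReal_norm, norm_phase, ENNReal.ofReal_one]

theorem conj_phase (r : ℝ) : (starRingEnd ℂ) (Complex.exp (2 * Real.pi * Complex.I * (r : ℂ)))
    = Complex.exp (2 * Real.pi * Complex.I * ((-r : ℝ) : ℂ)) := by
  rw [← Complex.exp_conj]
  congr 1
  simp only [map_mul, Complex.conj_ofReal, Complex.conj_I, map_ofNat]
  push_cast; ring

theorem phase_add (r s : ℝ) : Complex.exp (2 * Real.pi * Complex.I * ((r + s : ℝ) : ℂ))
    = Complex.exp (2 * Real.pi * Complex.I * (r : ℂ))
      * Complex.exp (2 * Real.pi * Complex.I * (s : ℂ)) := by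
  rw [← Complex.exp_add]; congr 1; push_cast; ring

theorem conj_phase_mul_phase (r : ℝ) :
    (starRingEnd ℂ) (Complex.exp (2 * Real.pi * Complex.I * (r : ℂ)))
      * Complex.exp (2 * Real.pi * Complex.I * (r : ℂ)) = 1 := by
  rw [conj_phase, ← phase_add]; simp

theorem ae_comp_sub {p : ℝ → Prop} (h : ∀ᵐ t : ℝ, p t) (s : ℝ) : ∀ᵐ t : ℝ, p (t - s) :=
  (measurePreserving_sub_right volume s).quasiMeasurePreserving.ae h

theorem coeFn_schrodinger (lam : ℝ) (n : Heis) (u : L2R) :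
    schrodinger lam n u =ᵐ[volume] fun t =>
      Complex.exp (2 * Real.pi * Complex.I * ((lam * n.z - lam * n.y * t : ℝ) : ℂ)) * u (t - n.x) :=
  MemLp.coeFn_toLp _

theorem coeFn_gabor (α β : ℝ) (u : L2R) (p : ℤ × ℤ) :
    gabor α β u p =ᵐ[volume] fun t =>
      Complex.exp (2 * Real.pi * Complex.I * ((β * p.2 * t : ℝ) : ℂ)) * u (t - α * p.1) :=
  MemLp.coeFn_toLp _

theorem schrodinger_add (lam : ℝ) (n : Heis) (u v : L2R) :
    schrodinger lam n (u + v) = schrodinger lam n u + schrodinger lam n v := by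
  refine Lp.ext ?_
  filter_upwards [coeFn_schrodinger lam n (u + v), coeFn_schrodinger lam n u,
    coeFn_schrodinger lam n v, Lp.coeFn_add (schrodinger lam n u) (schrodinger lam n v),
    ae_comp_sub (Lp.coeFn_add u v) n.x] with t h1 h2 h3 h4 h5
  rw [h1, h4, Pi.add_apply, h2, h3, h5, Pi.add_apply, mul_add]

theorem schrodinger_smul (lam : ℝ) (n : Heis) (c : ℂ) (u : L2R) :
    schrodinger lam n (c • u) = c • schrodinger lam n u := by
  refine Lp.ext ?_
  filter_upwards [coeFn_schrodinger lam n (c • u), coeFn_schrodinger lam n u,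
    Lp.coeFn_smul c (schrodinger lam n u), ae_comp_sub (Lp.coeFn_smul c u) n.x] with t h1 h2 h4 h5
  rw [h1, h4, Pi.smul_apply, h2, h5, Pi.smul_apply, smul_eq_mul, smul_eq_mul]
  ring

theorem gabor_smul (α β : ℝ) (p : ℤ × ℤ) (c : ℂ) (u : L2R) :
    gabor α β (c • u) p = c • gabor α β u p := by
  refine Lp.ext ?_
  filter_upwards [coeFn_gabor α β (c • u) p, coeFn_gabor α β u p,
    Lp.coeFn_smul c (gabor α β u p), ae_comp_sub (Lp.coeFn_smul c u) (α * p.1)] with t h1 h2 h4 h5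
  rw [h1, h4, Pi.smul_apply, h2, h5, Pi.smul_apply, smul_eq_mul, smul_eq_mul]
  ring

theorem gabor_star (α β : ℝ) (i k : ℤ) (u : L2R) :
    gabor α β (star u) (i, k) = star (gabor α β u (i, -k)) := by
  refine Lp.ext ?_
  filter_upwards [coeFn_gabor α β (star u) (i, k), coeFn_gabor α β u (i, -k),
    Lp.coeFn_star (gabor α β u (i, -k)), ae_comp_sub (Lp.coeFn_star u) (α * i)] with t h1 h2 h4 h5
  rw [h1, h4, Pi.star_apply, h2, h5, Pi.star_apply, star_mul', ← starRingEnd_apply (Complex.exp _),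
    conj_phase]
  push_cast
  congr 3
  ring

theorem schrodinger_mul (lam : ℝ) (m n : Heis) (u : L2R) :
    schrodinger lam (m * n) u = schrodinger lam m (schrodinger lam n u) := by
  refine Lp.ext ?_
  filter_upwards [coeFn_schrodinger lam (m * n) u, coeFn_schrodinger lam m (schrodinger lam n u),
    ae_comp_sub (coeFn_schrodinger lam n u) m.x] with t h1 h2 h3
  rw [h1, h2, h3, ← mul_assoc, ← phase_add]
  congr 1
  · congr 3
    simp only [Heis.z_mul, Heis.y_mul]
    ring
  · rw [Heis.x_mul, sub_sub]

theorem inner_L2_eq {α : Type*} [MeasurableSpace α] {μ : Measure α} (u v : Lp ℂ 2 μ) :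
    inner ℂ u v = ∫ t, v t * (starRingEnd ℂ) (u t) ∂μ := by
  rw [L2.inner_def]; rfl

theorem inner_schrodinger_schrodinger (lam : ℝ) (n : Heis) (u v : L2R) :
    inner ℂ (schrodinger lam n u) (schrodinger lam n v) = inner ℂ u v := by
  rw [inner_L2_eq, inner_L2_eq,
    ← integral_sub_right_eq_self (fun t => v t * (starRingEnd ℂ) (u t)) n.x]
  refine integral_congr_ae ?_
  filter_upwards [coeFn_schrodinger lam n u, coeFn_schrodinger lam n v] with t h1 h2
  rw [h1, h2, map_mul, mul_mul_mul_comm, mul_comm (Complex.exp _), conj_phase_mul_phase, one_mul]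

theorem norm_schrodinger (lam : ℝ) (n : Heis) (u : L2R) : ‖schrodinger lam n u‖ = ‖u‖ := by
  rw [@norm_eq_sqrt_re_inner ℂ, inner_schrodinger_schrodinger, ← @norm_eq_sqrt_re_inner ℂ]

/-- By unitarity `π(γ)⁻¹` crosses the inner product. This is how biregular translations turn into
multiplication of the Fourier transform by Schrödinger operators. -/
theorem inner_schrodinger_translate (lam : ℝ) (γ n η : Heis) (u v : L2R) :
    inner ℂ u (schrodinger lam (γ⁻¹ * n * η) v)
      = inner ℂ (schrodinger lam γ u) (schrodinger lam n (schrodinger lam η v)) := by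
  rw [← inner_schrodinger_schrodinger lam γ, ← schrodinger_mul, ← schrodinger_mul]
  congr 2
  group

theorem inner_schrodinger_eq_integral (lam : ℝ) (n : Heis) (u v : L2R) :
    inner ℂ v (schrodinger lam n u) = ∫ t, Complex.exp (2 * Real.pi * Complex.I *
      ((lam * n.z - lam * n.y * t : ℝ) : ℂ)) * u (t - n.x) * (starRingEnd ℂ) (v t) := by
  rw [inner_L2_eq]
  refine integral_congr_ae ?_
  filter_upwards [coeFn_schrodinger lam n u] with t h1
  rw [h1]

/-- The separation on which the sum over `Λ` rests: the central integer yields a scalar character in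
`λ`, the other two a Gabor shift, with frequency `-k₂` because of the sign in the representation. -/
theorem schrodinger_int (lam : ℝ) (k₁ k₂ k₃ : ℤ) (u : L2R) :
    schrodinger lam (Heis.mk k₃ k₂ k₁) u
      = Complex.exp (2 * Real.pi * Complex.I * ((lam * k₁ : ℝ) : ℂ)) • gabor 1 lam u (k₃, -k₂) := by
  refine Lp.ext ?_
  filter_upwards [coeFn_schrodinger lam (Heis.mk k₃ k₂ k₁) u, coeFn_gabor 1 lam u (k₃, -k₂),
    Lp.coeFn_smul (Complex.exp (2 * Real.pi * Complex.I * ((lam * k₁ : ℝ) : ℂ)))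
      (gabor 1 lam u (k₃, -k₂))] with t h1 h2 h3
  rw [h1, h3, Pi.smul_apply, h2, smul_eq_mul, ← mul_assoc, ← phase_add]
  simp only [Heis.x_mk, Heis.y_mk, Heis.z_mk, one_mul]
  congr 3
  push_cast
  ring

theorem schrodinger_int_zero (lam : ℝ) (k₂ k₃ : ℤ) (u : L2R) :
    schrodinger lam (Heis.mk k₃ k₂ 0) u = gabor 1 lam u (k₃, -k₂) := by
  have := schrodinger_int lam 0 k₂ k₃ u
  simpa using this

theorem inner_star_star (u v : L2R) : inner ℂ (star u) (star v) = inner ℂ v u := by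
  rw [inner_L2_eq, inner_L2_eq]
  refine integral_congr_ae ?_
  filter_upwards [Lp.coeFn_star u, Lp.coeFn_star v] with t h1 h2
  rw [h1, h2, Pi.star_apply, Pi.star_apply, starRingEnd_apply, starRingEnd_apply, star_star,
    mul_comm]

theorem enorm_star_L2 (u : L2R) : ‖star u‖ₑ = ‖u‖ₑ := by
  rw [← ofReal_norm, ← ofReal_norm, @norm_eq_sqrt_re_inner ℂ, inner_star_star,
    ← @norm_eq_sqrt_re_inner ℂ]

/-- The Gabor systems in the form in which they occur in the Schrödinger representation. -/
theorem tsum_enorm_inner_gabor {lam c : ℝ} {u : L2R}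
    (hu : IsParsevalFrame (gabor 1 lam ((c : ℂ) • u))) (w : L2R) :
    ∑' p : ℤ × ℤ, ‖inner ℂ w ((c : ℂ) • gabor 1 lam u p)‖ₑ ^ 2 = ‖w‖ₑ ^ 2 := by
  simpa only [gabor_smul] using hu.tsum_enorm w

/-- Complex conjugation is antiunitary and only permutes the Gabor shifts by `k ↦ -k`, so `v`
generates a Parseval frame when its conjugate does. -/
theorem tsum_enorm_inner_gabor_of_star {lam c : ℝ} {v : L2R}
    (hv : IsParsevalFrame (gabor 1 lam ((c : ℂ) • star v))) (w : L2R) :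
    ∑' p : ℤ × ℤ, ‖inner ℂ w ((c : ℂ) • gabor 1 lam v p)‖ₑ ^ 2 = ‖w‖ₑ ^ 2 := by
  rw [← enorm_star_L2 w, ← tsum_enorm_inner_gabor hv (star w),
    ← (Equiv.prodCongr (Equiv.refl ℤ) (Equiv.neg ℤ)).tsum_eq]
  refine tsum_congr fun p => ?_
  obtain ⟨i, k⟩ := p
  simp only [Equiv.prodCongr_apply, Prod.map, Equiv.refl_apply, Equiv.neg_apply, gabor_star,
    inner_smul_right, enorm_mul, inner_star_star]
  rw [enorm_inner_symm w]

/-! ### The operator-valued Fourier transform of integrable functions -/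

instance : SigmaFinite (volume : Measure Heis) :=
  inferInstanceAs (SigmaFinite (volume : Measure (ℝ × ℝ × ℝ)))

theorem Heis.measurable_x : Measurable Heis.x := measurable_fst

theorem Heis.measurable_y : Measurable Heis.y := measurable_fst.comp measurable_snd

theorem Heis.measurable_z : Measurable Heis.z := measurable_snd.comp measurable_snd

/-- The coordinates of the Heisenberg group with the central one split off. -/
def heisEquiv : (ℝ × ℝ) × ℝ ≃ᵐ Heis := MeasurableEquiv.prodAssoc

theorem heisEquiv_apply (p : ℝ × ℝ) (z : ℝ) : heisEquiv (p, z) = Heis.mk p.1 p.2 z := rfl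

theorem measurePreserving_heisEquiv : MeasurePreserving heisEquiv :=
  volume_preserving_prodAssoc (α₁ := ℝ) (β₁ := ℝ) (γ₁ := ℝ)

theorem stronglyMeasurable_inner_schrodinger (u v : L2R) : StronglyMeasurable
    (fun p : ℝ × Heis => (inner ℂ v (schrodinger p.1 p.2 u) : ℂ)) := by
  have hu := (Lp.stronglyMeasurable u).measurable
  have hv := (Lp.stronglyMeasurable v).measurable
  simp only [inner_schrodinger_eq_integral]
  refine StronglyMeasurable.integral_prod_right (f := fun (p : ℝ × Heis) (t : ℝ) =>
    Complex.exp (2 * Real.pi * Complex.I * ((p.1 * p.2.z - p.1 * p.2.y * t : ℝ) : ℂ))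
      * u (t - p.2.x) * (starRingEnd ℂ) (v t)) (Measurable.stronglyMeasurable ?_)
  have hx := Heis.measurable_x
  have hy := Heis.measurable_y
  have hz := Heis.measurable_z
  have hc : Measurable (fun z : ℂ => (starRingEnd ℂ) z) := Complex.continuous_conj.measurable
  simp only [Function.uncurry_def]
  fun_prop

theorem norm_inner_schrodinger_le (lam : ℝ) (n : Heis) (u v : L2R) :
    ‖(inner ℂ v (schrodinger lam n u) : ℂ)‖ ≤ ‖v‖ * ‖u‖ := by
  rw [← norm_schrodinger lam n u]
  exact norm_inner_le_norm _ _

theorem integrable_mul_inner_schrodinger {g : Heis → ℂ} (hg : Integrable g) (lam : ℝ) (u v : L2R) :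
    Integrable (fun n => g n * inner ℂ v (schrodinger lam n u)) :=
  hg.mul_bdd
    ((stronglyMeasurable_inner_schrodinger u v).comp_measurable
      measurable_prodMk_left).aestronglyMeasurable
    (ae_of_all _ fun n => norm_inner_schrodinger_le lam n u v)

/-- The weak integral is a sesquilinear form bounded by `‖g‖₁`, since the representation is unitary,
so Riesz gives an operator. The adjoint appears because `continuousLinearMapOfBilin` places the
operator in the first slot of the inner product. -/
theorem exists_isFourierAt {g : L2H} (hg : Integrable g) (lam : ℝ) :
    ∃ T, IsFourierAt g lam T := by
  have hi := integrable_mul_inner_schrodinger hg lam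
  let B : L2R →L⋆[ℂ] L2R →L[ℂ] ℂ := LinearMap.mkContinuous₂
    (LinearMap.mk₂'ₛₗ (starRingEnd ℂ) (RingHom.id ℂ)
      (fun v u => ∫ n, g n * inner ℂ v (schrodinger lam n u))
      (fun v w u => by
        rw [← integral_add (hi u v) (hi u w)]
        simp only [inner_add_left, mul_add])
      (fun c v u => by
        rw [smul_eq_mul, ← integral_const_mul]
        refine integral_congr_ae (ae_of_all _ fun n => ?_)
        simp only [inner_smul_left]; ring)
      (fun v u w => by
        rw [← integral_add (hi u v) (hi w v)]
        simp only [schrodinger_add, inner_add_right, mul_add])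
      (fun c v u => by
        rw [smul_eq_mul, RingHom.id_apply, ← integral_const_mul]
        refine integral_congr_ae (ae_of_all _ fun n => ?_)
        simp only [schrodinger_smul, inner_smul_right]; ring))
    (∫ n, ‖g n‖) (fun v u => by
      rw [LinearMap.mk₂'ₛₗ_apply, mul_assoc, ← integral_mul_const]
      refine norm_integral_le_of_norm_le (hg.norm.mul_const _) (ae_of_all _ fun n => ?_)
      rw [norm_mul]
      gcongr
      exact norm_inner_schrodinger_le _ _ _ _)
  refine ⟨(InnerProductSpace.continuousLinearMapOfBilin B).adjoint, fun u v => ?_⟩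
  rw [ContinuousLinearMap.adjoint_inner_right, InnerProductSpace.continuousLinearMapOfBilin_apply]
  rfl

theorem weaklyMeasurable_of_isFourierAt {g : L2H} {G : ℝ → L2R →L[ℂ] L2R}
    (hG : ∀ lam, lam ≠ 0 → IsFourierAt g lam (G lam)) : WeaklyMeasurable G := by
  intro u v
  have h : StronglyMeasurable fun lam : ℝ => ∫ n : Heis, g n * inner ℂ v (schrodinger lam n u) :=
    StronglyMeasurable.integral_prod_right
      (f := fun (lam : ℝ) (n : Heis) => g n * inner ℂ v (schrodinger lam n u))
      (((Lp.stronglyMeasurable g).comp_measurable measurable_snd).mul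
        (stronglyMeasurable_inner_schrodinger u v))
  refine h.aestronglyMeasurable.congr ?_
  have h0 : ∀ᵐ x : ℝ, x ≠ 0 := by simp [ae_iff]
  filter_upwards [h0] with lam hlam
  rw [hG lam hlam u v]

/-! ### The Hilbert-Schmidt norm of a Weyl transform -/

theorem lintegral_comp_const_mul {c : ℝ} (hc : c ≠ 0) (f : ℝ → ℝ≥0∞) :
    ‖c‖ₑ * ∫⁻ t, f (c * t) = ∫⁻ t, f t := by
  have h := (Homeomorph.mulLeft₀ c hc).measurableEmbedding.lintegral_map (μ := volume) f
  rw [Homeomorph.coe_mulLeft₀, Real.map_volume_mul_left hc, lintegral_smul_measure] at h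
  rw [← h, smul_eq_mul, ← mul_assoc, abs_inv, ← Real.norm_eq_abs, ENNReal.ofReal_inv_of_pos
    (norm_pos_iff.2 hc), ofReal_norm, ENNReal.mul_inv_cancel (by simpa) (by simp), one_mul]

theorem memLp_two_iff_lintegral {α : Type*} [MeasurableSpace α] {μ : Measure α} {f : α → ℂ}
    (hf : AEStronglyMeasurable f μ) : MemLp f 2 μ ↔ ∫⁻ x, ‖f x‖ₑ ^ 2 ∂μ < ∞ := by
  rw [MemLp, eLpNorm_lt_top_iff_lintegral_rpow_enorm_lt_top (by norm_num) (by norm_num)]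
  simp [hf]

theorem enorm_mul_le_add_sq (a b : ℝ≥0∞) : a * b ≤ a ^ 2 + b ^ 2 := by
  rcases le_total a b with h | h
  · calc a * b ≤ b * b := by gcongr
      _ ≤ a ^ 2 + b ^ 2 := by rw [sq b]; exact le_add_self
  · calc a * b ≤ a * a := by gcongr
      _ ≤ a ^ 2 + b ^ 2 := by rw [sq a]; exact le_self_add

/-- The integrand in the matrix coefficients of a Weyl transform. -/
theorem integrable_weyl {p : ℝ × ℝ → ℂ} (hp : StronglyMeasurable p) (h1 : Integrable p) (lam : ℝ)
    (u v : L2R) : Integrable (fun q : (ℝ × ℝ) × ℝ => p q.1 *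
      (Complex.exp (2 * Real.pi * Complex.I * ((-(lam * q.2 * q.1.2) : ℝ) : ℂ)) * u (q.2 - q.1.1)
        * (starRingEnd ℂ) (v q.2))) ((volume : Measure (ℝ × ℝ)).prod volume) := by
  have hu := (Lp.stronglyMeasurable u).measurable
  have hv := (Lp.stronglyMeasurable v).measurable
  have hc : Measurable (fun z : ℂ => (starRingEnd ℂ) z) := Complex.continuous_conj.measurable
  have hp' := hp.measurable
  have hm : Measurable (fun q : (ℝ × ℝ) × ℝ => p q.1 *
      (Complex.exp (2 * Real.pi * Complex.I * ((-(lam * q.2 * q.1.2) : ℝ) : ℂ)) * u (q.2 - q.1.1)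
        * (starRingEnd ℂ) (v q.2))) := by fun_prop
  refine ⟨hm.aestronglyMeasurable, ?_⟩
  rw [HasFiniteIntegral, lintegral_prod _ hm.enorm.aemeasurable]
  calc ∫⁻ x : ℝ × ℝ, ∫⁻ t : ℝ, ‖p x * (Complex.exp (2 * Real.pi * Complex.I *
        ((-(lam * t * x.2) : ℝ) : ℂ)) * u (t - x.1) * (starRingEnd ℂ) (v t))‖ₑ
      ≤ ∫⁻ x : ℝ × ℝ, ‖p x‖ₑ * (‖u‖ₑ ^ 2 + ‖v‖ₑ ^ 2) := by
        refine lintegral_mono fun x => ?_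
        simp only [enorm_mul, enorm_phase, one_mul, RCLike.enorm_conj]
        rw [lintegral_const_mul _ (by fun_prop)]
        gcongr
        -- Only finiteness is needed, so `ab ≤ a² + b²` replaces the Cauchy–Schwarz inequality.
        calc ∫⁻ t, ‖u (t - x.1)‖ₑ * ‖v t‖ₑ
            ≤ ∫⁻ t, (‖u (t - x.1)‖ₑ ^ 2 + ‖v t‖ₑ ^ 2) :=
              lintegral_mono fun t => enorm_mul_le_add_sq _ _
          _ = _ := by
              rw [lintegral_add_left (by fun_prop),
                lintegral_sub_right_eq_self (fun t => ‖u t‖ₑ ^ 2), lintegral_enorm_sq_L2,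
                lintegral_enorm_sq_L2]
    _ < ∞ := by
        rw [lintegral_mul_const _ (by fun_prop)]
        have := h1.2
        rw [HasFiniteIntegral] at this
        finiteness

/-- The partial Fourier transform in the second variable. -/
def fourierSnd (p : ℝ × ℝ → ℂ) (x η : ℝ) : ℂ :=
  ∫ y, Complex.exp (2 * Real.pi * Complex.I * ((-(η * y) : ℝ) : ℂ)) * p (x, y)

theorem measurable_fourierSnd {p : ℝ × ℝ → ℂ} (hp : StronglyMeasurable p) :
    Measurable (fun q : ℝ × ℝ => fourierSnd p q.1 q.2) := by
  have hp' := hp.measurable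
  refine (StronglyMeasurable.integral_prod_right (f := fun (q : ℝ × ℝ) (y : ℝ) =>
    Complex.exp (2 * Real.pi * Complex.I * ((-(q.2 * y) : ℝ) : ℂ)) * p (q.1, y))
    (Measurable.stronglyMeasurable ?_)).measurable
  simp only [Function.uncurry_def]
  fun_prop

theorem ae_integrable_memLp_section {p : ℝ × ℝ → ℂ} (hp : StronglyMeasurable p) (h1 : Integrable p)
    (h2 : MemLp p 2) : ∀ᵐ x : ℝ, Integrable (fun y => p (x, y)) ∧ MemLp (fun y => p (x, y)) 2 := by
  have hp' := hp.measurable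
  have h3 := (memLp_two_iff_lintegral hp.aestronglyMeasurable).1 h2
  rw [Measure.volume_eq_prod, lintegral_prod _ (by fun_prop)] at h3
  have h4 := ae_lt_top (by fun_prop) h3.ne
  filter_upwards [h1.prod_right_ae, h4] with x hx1 hx2
  exact ⟨hx1, (memLp_two_iff_lintegral hx1.aestronglyMeasurable).2 hx2⟩

theorem lintegral_fourierSnd {p : ℝ × ℝ → ℂ} (hp : StronglyMeasurable p) (h1 : Integrable p)
    (h2 : MemLp p 2) : ∫⁻ x : ℝ, ∫⁻ η : ℝ, ‖fourierSnd p x η‖ₑ ^ 2 = ∫⁻ q, ‖p q‖ₑ ^ 2 := by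
  have hp' := hp.measurable
  rw [Measure.volume_eq_prod, lintegral_prod _ (by fun_prop)]
  refine lintegral_congr_ae ?_
  filter_upwards [ae_integrable_memLp_section hp h1 h2] with x ⟨hx1, hx2⟩
  rw [← lintegral_enorm_fourier_sq hx1 hx2]
  simp only [fourierSnd, fourier_eq_integral_exp]

/-- The phase `e^{-2πiλty}` is the only place where `y` meets `t`, so integrating out `y` evaluates
the partial Fourier transform at `λt`. The operator thus has the kernel `(t, s) ↦ fourierSnd p (t -
s) (λt)`. The pointwise formula is extracted from the weak one by testing against indicators. -/
theorem weyl_ae_eq {p : ℝ × ℝ → ℂ} (hp : StronglyMeasurable p) (h1 : Integrable p)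
    {lam : ℝ} {T : L2R →L[ℂ] L2R} (hT : ∀ u v : L2R, inner ℂ v (T u)
      = ∫ q : ℝ × ℝ, p q * inner ℂ v (schrodinger lam (Heis.mk q.1 q.2 0) u)) (u : L2R) :
    T u =ᵐ[volume] fun t => ∫ x, fourierSnd p x (lam * t) * u (t - x) := by
  set w : ℝ → ℂ := fun t => ∫ q : ℝ × ℝ, p q *
    (Complex.exp (2 * Real.pi * Complex.I * ((-(lam * t * q.2) : ℝ) : ℂ)) * u (t - q.1)) with hw
  have hv : ∀ v : L2R, Integrable (fun t => w t * (starRingEnd ℂ) (v t)) ∧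
      ∫ t, T u t * (starRingEnd ℂ) (v t) = ∫ t, w t * (starRingEnd ℂ) (v t) := by
    intro v
    have hi := integrable_weyl hp h1 lam u v
    have e1 : ∀ t, ∫ q : ℝ × ℝ, p q * (Complex.exp (2 * Real.pi * Complex.I *
        ((-(lam * t * q.2) : ℝ) : ℂ)) * u (t - q.1) * (starRingEnd ℂ) (v t))
        = w t * (starRingEnd ℂ) (v t) := by
      intro t
      rw [hw, ← integral_mul_const]
      simp only [mul_assoc]
    refine ⟨?_, ?_⟩
    · have := hi.integral_prod_right
      simpa only [e1] using this
    · rw [← inner_L2_eq, hT, ← integral_congr_ae (ae_of_all _ e1),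
        ← integral_integral_swap (f := fun (q : ℝ × ℝ) (t : ℝ) => p q * (Complex.exp (2 * Real.pi *
          Complex.I * ((-(lam * t * q.2) : ℝ) : ℂ)) * u (t - q.1) * (starRingEnd ℂ) (v t))) hi]
      refine integral_congr_ae (ae_of_all _ fun q => ?_)
      simp only [inner_schrodinger_eq_integral, integral_const_mul, Heis.x_mk, Heis.y_mk, Heis.z_mk]
      have hphase : ∀ t : ℝ, lam * 0 - lam * q.2 * t = -(lam * t * q.2) := fun t => by ring
      simp only [hphase]
  have hind : ∀ s : Set ℝ, MeasurableSet s → volume s < ∞ →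
      ∃ v : L2R, ∀ᵐ t, (starRingEnd ℂ) (v t) = s.indicator 1 t := by
    intro s hs hs'
    refine ⟨indicatorConstLp 2 hs hs'.ne 1, ?_⟩
    filter_upwards [indicatorConstLp_coeFn (p := 2) (hs := hs) (hμs := hs'.ne) (c := (1 : ℂ))]
      with t ht
    rw [ht]
    by_cases h : t ∈ s <;> simp [h]
  have hind2 : ∀ s : Set ℝ, ∀ φ : ℝ → ℂ, ∀ v : L2R,
      (∀ᵐ t, (starRingEnd ℂ) (v t) = s.indicator 1 t) →
      (fun t => φ t * (starRingEnd ℂ) (v t)) =ᵐ[volume] s.indicator φ := by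
    intro s φ v h
    filter_upwards [h] with t ht
    rw [ht]
    by_cases h : t ∈ s <;> simp [h]
  have hTw : T u =ᵐ[volume] w := by
    refine ae_eq_of_forall_setIntegral_eq_of_sigmaFinite (fun s hs hs' => ?_) (fun s hs hs' => ?_)
      fun s hs hs' => ?_
    · exact integrableOn_Lp_of_measure_ne_top _ (by norm_num) hs'.ne
    · obtain ⟨v, hv1⟩ := hind s hs hs'
      exact (integrable_indicator_iff hs).1 ((hv v).1.congr (hind2 s w v hv1))
    · obtain ⟨v, hv1⟩ := hind s hs hs'
      rw [← integral_indicator hs, ← integral_indicator hs,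
        ← integral_congr_ae (hind2 s w v hv1), ← integral_congr_ae (hind2 s (T u) v hv1)]
      exact (hv v).2
  -- Fubini gives integrability only of the product with `v t`; letting `v` be the indicators of
  -- balls that exhaust the line removes this factor.
  have hint : ∀ᵐ t : ℝ, Integrable (fun q : ℝ × ℝ => p q *
      (Complex.exp (2 * Real.pi * Complex.I * ((-(lam * t * q.2) : ℝ) : ℂ)) * u (t - q.1))) := by
    have h : ∀ n : ℕ, ∀ᵐ t : ℝ, t ∈ Metric.ball (0 : ℝ) n → Integrable (fun q : ℝ × ℝ => p q *
        (Complex.exp (2 * Real.pi * Complex.I * ((-(lam * t * q.2) : ℝ) : ℂ)) * u (t - q.1))) := by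
      intro n
      obtain ⟨v, hv1⟩ := hind (Metric.ball (0 : ℝ) n) measurableSet_ball measure_ball_lt_top
      filter_upwards [(integrable_weyl hp h1 lam u v).prod_left_ae, hv1] with t ht hvt hmem
      simpa [hvt, hmem] using ht
    filter_upwards [ae_all_iff.2 h] with t ht
    obtain ⟨n, hn⟩ := exists_nat_gt ‖t‖
    exact ht n (by simpa using hn)
  filter_upwards [hTw, hint] with t ht hi
  rw [ht, hw]
  simp only
  rw [Measure.volume_eq_prod, integral_prod _ hi]
  refine integral_congr_ae (ae_of_all _ fun x => ?_)
  simp only [fourierSnd]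
  rw [← integral_mul_const]
  refine integral_congr_ae (ae_of_all _ fun y => ?_)
  simp only
  ring

/-- Plancherel's formula for Weyl transforms. -/
theorem enorm_mul_hsNormSq_weyl {p : ℝ × ℝ → ℂ} (hp : StronglyMeasurable p) (h1 : Integrable p)
    (h2 : MemLp p 2) {lam : ℝ} (hlam : lam ≠ 0) {T : L2R →L[ℂ] L2R}
    (hT : ∀ u v : L2R, inner ℂ v (T u)
      = ∫ q : ℝ × ℝ, p q * inner ℂ v (schrodinger lam (Heis.mk q.1 q.2 0) u)) :
    ‖lam‖ₑ * hsNormSq T = ∫⁻ q, ‖p q‖ₑ ^ 2 := by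
  have hq := measurable_fourierSnd hp
  have hswap : ∫⁻ η : ℝ, ∫⁻ x : ℝ, ‖fourierSnd p x η‖ₑ ^ 2 = ∫⁻ q, ‖p q‖ₑ ^ 2 := by
    rw [← lintegral_fourierSnd hp h1 h2]
    exact lintegral_lintegral_swap (by
      have : Measurable fun q : ℝ × ℝ => fourierSnd p q.2 q.1 := hq.comp measurable_swap
      simp only [Function.uncurry_def]
      fun_prop)
  have hfin : ∀ᵐ η : ℝ, ∫⁻ x : ℝ, ‖fourierSnd p x η‖ₑ ^ 2 < ∞ := by
    refine ae_lt_top (Measurable.lintegral_prod_left (by fun_prop)) ?_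
    rw [hswap]
    exact ((memLp_two_iff_lintegral hp.aestronglyMeasurable).1 h2).ne
  have hfin' : ∀ᵐ t : ℝ, ∫⁻ x : ℝ, ‖fourierSnd p x (lam * t)‖ₑ ^ 2 < ∞ :=
    (quasiMeasurePreserving_const_mul hlam).ae hfin
  calc ‖lam‖ₑ * hsNormSq T
      = ‖lam‖ₑ * ∑' k, ∫⁻ t, ‖T (hsBasis k) t‖ₑ ^ 2 := by
        simp only [lintegral_enorm_sq_L2, hsNormSq_eq]
    _ = ‖lam‖ₑ * ∫⁻ t, ∑' k, ‖T (hsBasis k) t‖ₑ ^ 2 := by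
        rw [lintegral_tsum fun k => (Lp.aestronglyMeasurable _).enorm.pow_const 2]
    _ = ‖lam‖ₑ * ∫⁻ t, ∫⁻ x, ‖fourierSnd p x (lam * t)‖ₑ ^ 2 := by
        congr 1
        refine lintegral_congr_ae ?_
        filter_upwards [hfin', ae_all_iff.2 fun k => weyl_ae_eq hp h1 hT (hsBasis k)] with t ht hk
        have hmt : Measurable fun x => fourierSnd p (t - x) (lam * t) :=
          hq.comp (measurable_const.sub measurable_id |>.prodMk measurable_const)
        -- The conjugated row of the kernel at `t`. The value of `T e_k` at `t` is its inner product
        -- with `e_k`, so Parseval in `k` gives the `L²` norm of the row.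
        have hmem : MemLp (fun x => (starRingEnd ℂ) (fourierSnd p (t - x) (lam * t))) 2 := by
          have hc : Measurable (fun z : ℂ => (starRingEnd ℂ) z) :=
            Complex.continuous_conj.measurable
          refine (memLp_two_iff_lintegral (hc.comp hmt).aestronglyMeasurable).2 ?_
          simp only [Function.comp_apply, RCLike.enorm_conj]
          rwa [lintegral_sub_left_eq_self (fun x => ‖fourierSnd p x (lam * t)‖ₑ ^ 2)]
        calc ∑' k, ‖T (hsBasis k) t‖ₑ ^ 2
            = ∑' k, ‖inner ℂ (hmem.toLp _) (hsBasis k)‖ₑ ^ 2 := by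
              refine tsum_congr fun k => ?_
              rw [hk, inner_L2_eq,
                ← integral_sub_left_eq_self (fun x => fourierSnd p x (lam * t) *
                  hsBasis k (t - x)) volume t]
              congr 2
              refine integral_congr_ae ?_
              filter_upwards [hmem.coeFn_toLp] with x hx
              rw [hx, RCLike.conj_conj, sub_sub_cancel, mul_comm]
          _ = ‖hmem.toLp _‖ₑ ^ 2 := tsum_enorm_inner_hsBasis _
          _ = ∫⁻ x, ‖fourierSnd p (t - x) (lam * t)‖ₑ ^ 2 := by
              rw [← lintegral_enorm_sq_L2]
              refine lintegral_congr_ae ?_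
              filter_upwards [hmem.coeFn_toLp] with x hx
              rw [hx, RCLike.enorm_conj]
          _ = _ := lintegral_sub_left_eq_self (fun x => ‖fourierSnd p x (lam * t)‖ₑ ^ 2) t
    _ = ∫⁻ η : ℝ, ∫⁻ x : ℝ, ‖fourierSnd p x η‖ₑ ^ 2 :=
        lintegral_comp_const_mul hlam fun η => ∫⁻ x : ℝ, ‖fourierSnd p x η‖ₑ ^ 2
    _ = _ := hswap

/-! ### Plancherel's theorem on the Heisenberg group -/

/-- The partial Fourier transform in the central variable. -/
def fourierCentral (g : Heis → ℂ) (lam : ℝ) (p : ℝ × ℝ) : ℂ :=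
  ∫ z, Complex.exp (2 * Real.pi * Complex.I * ((lam * z : ℝ) : ℂ)) * g (Heis.mk p.1 p.2 z)

/-- The density of the Plancherel formula with respect to Lebesgue measure. -/
def plancherelDensity (g : Heis → ℂ) (lam : ℝ) : ℝ≥0∞ :=
  ∫⁻ p : ℝ × ℝ, ‖fourierCentral g lam p‖ₑ ^ 2

theorem measurable_fourierCentral {g : Heis → ℂ} (hg : Measurable g) :
    Measurable (fun q : ℝ × (ℝ × ℝ) => fourierCentral g q.1 q.2) := by
  refine (StronglyMeasurable.integral_prod_right (f := fun (q : ℝ × (ℝ × ℝ)) (z : ℝ) =>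
    Complex.exp (2 * Real.pi * Complex.I * ((q.1 * z : ℝ) : ℂ)) * g (heisEquiv (q.2, z)))
    (Measurable.stronglyMeasurable ?_)).measurable
  have he := heisEquiv.measurable
  simp only [Function.uncurry_def]
  fun_prop

theorem measurable_plancherelDensity {g : Heis → ℂ} (hg : Measurable g) :
    Measurable (plancherelDensity g) := by
  have := measurable_fourierCentral hg
  exact Measurable.lintegral_prod_right'
    (f := fun q : ℝ × (ℝ × ℝ) => ‖fourierCentral g q.1 q.2‖ₑ ^ 2) (by fun_prop)

theorem integrable_comp_heisEquiv {g : Heis → ℂ} (h1 : Integrable g) :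
    Integrable (fun q => g (heisEquiv q)) ((volume : Measure (ℝ × ℝ)).prod volume) :=
  (measurePreserving_heisEquiv.integrable_comp_emb heisEquiv.measurableEmbedding).2 h1

/-- Plancherel on the line in the central variable, for almost every `(x, y)`, and Tonelli. The
reflection of `λ` accounts for the positive sign in the phase of `fourierCentral`. -/
theorem lintegral_plancherelDensity {g : Heis → ℂ} (hg : Measurable g) (h1 : Integrable g)
    (h2 : ∫⁻ n, ‖g n‖ₑ ^ 2 < ∞) : ∫⁻ lam, plancherelDensity g lam = ∫⁻ n, ‖g n‖ₑ ^ 2 := by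
  have hm := measurable_fourierCentral hg
  have he := heisEquiv.measurable
  rw [← measurePreserving_heisEquiv.lintegral_comp_emb heisEquiv.measurableEmbedding] at h2 ⊢
  rw [Measure.volume_eq_prod, lintegral_prod _ (by fun_prop)] at h2 ⊢
  simp only [plancherelDensity]
  rw [lintegral_lintegral_swap (by simp only [Function.uncurry_def]; fun_prop)]
  refine lintegral_congr_ae ?_
  filter_upwards [(integrable_comp_heisEquiv h1).prod_right_ae, ae_lt_top (by fun_prop) h2.ne]
    with p hp1 hp2
  rw [← lintegral_enorm_fourier_sq hp1
    ((memLp_two_iff_lintegral hp1.aestronglyMeasurable).2 hp2), ← lintegral_neg_eq_self]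
  simp only [fourier_eq_integral_exp, fourierCentral, heisEquiv_apply, neg_mul]

/-- The centre acts by the scalars `e^{2πiλz}`, so integrating over `z` first exhibits `T` as the
Weyl transform of `fourierCentral g lam`. -/
theorem IsFourierAt.inner_eq {g : L2H} (h1 : Integrable g) {lam : ℝ} {T : L2R →L[ℂ] L2R}
    (hT : IsFourierAt g lam T) (u v : L2R) : inner ℂ v (T u)
      = ∫ q : ℝ × ℝ, fourierCentral g lam q * inner ℂ v (schrodinger lam (Heis.mk q.1 q.2 0) u) := by
  have hi : Integrable (fun q => g (heisEquiv q) * inner ℂ v (schrodinger lam (heisEquiv q) u))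
      ((volume : Measure (ℝ × ℝ)).prod volume) :=
    integrable_comp_heisEquiv (integrable_mul_inner_schrodinger h1 lam u v)
  rw [hT, ← measurePreserving_heisEquiv.integral_comp', Measure.volume_eq_prod, integral_prod _ hi]
  refine integral_congr_ae (ae_of_all _ fun q => ?_)
  simp only [fourierCentral]
  rw [← integral_mul_const]
  refine integral_congr_ae (ae_of_all _ fun z => ?_)
  have : Heis.mk q.1 q.2 z = Heis.mk 0 0 z * Heis.mk q.1 q.2 0 := by ext <;> simp
  have h : schrodinger lam (Heis.mk q.1 q.2 z) u
      = Complex.exp (2 * Real.pi * Complex.I * ((lam * z : ℝ) : ℂ)) •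
        schrodinger lam (Heis.mk q.1 q.2 0) u := by
    refine Lp.ext ?_
    filter_upwards [coeFn_schrodinger lam (Heis.mk q.1 q.2 z) u,
      coeFn_schrodinger lam (Heis.mk q.1 q.2 0) u,
      Lp.coeFn_smul (Complex.exp (2 * Real.pi * Complex.I * ((lam * z : ℝ) : ℂ)))
        (schrodinger lam (Heis.mk q.1 q.2 0) u)] with t h1 h2 h3
    rw [h1, h3, Pi.smul_apply, h2, smul_eq_mul, ← mul_assoc, ← phase_add]
    simp only [Heis.x_mk, Heis.y_mk, Heis.z_mk]
    congr 4
    ring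
  simp only [heisEquiv_apply, h, inner_smul_right]
  ring

/-- The Hilbert-Schmidt norms of the Fourier transform of an integrable function. -/
theorem ae_enorm_mul_hsNormSq {g : L2H} (h1 : Integrable g) :
    ∀ᵐ lam : ℝ, ∀ T : L2R →L[ℂ] L2R, IsFourierAt g lam T →
      ‖lam‖ₑ * hsNormSq T = plancherelDensity g lam := by
  have hg := (Lp.stronglyMeasurable g).measurable
  have h0 : ∀ᵐ x : ℝ, x ≠ 0 := by simp [ae_iff]
  have h2 : ∫⁻ n, ‖g n‖ₑ ^ 2 < ∞ := by
    rw [lintegral_enorm_sq_L2]; finiteness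
  have h3 := lintegral_plancherelDensity hg h1 h2
  have h4 := ae_lt_top (measurable_plancherelDensity hg) (by rw [h3]; exact h2.ne)
  filter_upwards [h0, h4] with lam hlam hfin T hT
  have hm : StronglyMeasurable (fourierCentral g lam) :=
    ((measurable_fourierCentral hg).comp measurable_prodMk_left).stronglyMeasurable
  have hi : Integrable (fourierCentral g lam) := by
    have : Integrable (fun q : (ℝ × ℝ) × ℝ => Complex.exp (2 * Real.pi * Complex.I *
        ((lam * q.2 : ℝ) : ℂ)) * g (heisEquiv q)) ((volume : Measure (ℝ × ℝ)).prod volume) := by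
      refine (integrable_comp_heisEquiv h1).bdd_mul (c := 1) ?_ (ae_of_all _ fun q => ?_)
      · exact Measurable.aestronglyMeasurable (by fun_prop)
      · rw [norm_phase]
    exact this.integral_prod_left
  exact enorm_mul_hsNormSq_weyl hm hi ((memLp_two_iff_lintegral hm.aestronglyMeasurable).2 hfin)
    hlam (hT.inner_eq h1)

theorem lintegral_hsNormSq_of_isFourierAt {g : L2H} (h1 : Integrable g) {G : ℝ → L2R →L[ℂ] L2R}
    (hG : ∀ lam, lam ≠ 0 → IsFourierAt g lam (G lam)) :
    ∫⁻ lam : ℝ, hsNormSq (G lam) * ‖lam‖ₑ = ‖g‖ₑ ^ 2 := by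
  have h0 : ∀ᵐ x : ℝ, x ≠ 0 := by simp [ae_iff]
  rw [← lintegral_enorm_sq_L2, ← lintegral_plancherelDensity
    (Lp.stronglyMeasurable g).measurable h1 (by rw [lintegral_enorm_sq_L2]; finiteness)]
  refine lintegral_congr_ae ?_
  filter_upwards [h0, ae_enorm_mul_hsNormSq h1] with lam hlam h
  rw [mul_comm, h _ (hG lam hlam)]

/-! ### The Plancherel transform -/

/-- The squared norm of a field of operators in the direct integral. -/
def fieldNormSq (F : ℝ → L2R →L[ℂ] L2R) : ℝ≥0∞ := ∫⁻ lam : ℝ, hsNormSq (F lam) * ‖lam‖ₑ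

theorem fieldNormSq_sub_comm (F G : ℝ → L2R →L[ℂ] L2R) :
    fieldNormSq (F - G) = fieldNormSq (G - F) := by
  simp only [fieldNormSq, Pi.sub_apply]
  refine lintegral_congr fun lam => ?_
  rw [hsNormSq_sub_comm]

theorem WeaklyMeasurable.sub {F G : ℝ → L2R →L[ℂ] L2R} (hF : WeaklyMeasurable F)
    (hG : WeaklyMeasurable G) : WeaklyMeasurable (F - G) := by
  have := hF.add (hG.smul (-1))
  rwa [neg_one_smul, ← sub_eq_add_neg] at this

theorem WeaklyMeasurable.aemeasurable_density {F : ℝ → L2R →L[ℂ] L2R} (hF : WeaklyMeasurable F) :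
    AEMeasurable fun lam : ℝ => hsNormSq (F lam) * ‖lam‖ₑ :=
  hF.aemeasurable_hsNormSq.mul measurable_enorm.aemeasurable

/-- Minkowski's inequality twice: for the Hilbert–Schmidt norm at each `λ`, then in `L²` of the
weighted line. -/
theorem sqrt_fieldNormSq_add_le {F G : ℝ → L2R →L[ℂ] L2R} (hF : WeaklyMeasurable F)
    (hG : WeaklyMeasurable G) : fieldNormSq (F + G) ^ (1 / 2 : ℝ)
      ≤ fieldNormSq F ^ (1 / 2 : ℝ) + fieldNormSq G ^ (1 / 2 : ℝ) := by
  have hsq : ∀ x : ℝ≥0∞, (x ^ (1 / 2 : ℝ)) ^ (2 : ℝ) = x := fun x => by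
    rw [← ENNReal.rpow_mul]; norm_num
  have h := ENNReal.lintegral_Lp_add_le (μ := (volume : Measure ℝ)) (p := 2)
    (f := fun lam => (hsNormSq (F lam) * ‖lam‖ₑ) ^ (1 / 2 : ℝ))
    (g := fun lam => (hsNormSq (G lam) * ‖lam‖ₑ) ^ (1 / 2 : ℝ))
    (hF.aemeasurable_density.pow_const _) (hG.aemeasurable_density.pow_const _) one_le_two
  simp only [hsq] at h
  refine le_trans ?_ h
  refine ENNReal.rpow_le_rpow (lintegral_mono fun lam => ?_) (by norm_num)
  rw [← hsq (hsNormSq ((F + G) lam) * ‖lam‖ₑ)]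
  refine ENNReal.rpow_le_rpow ?_ (by norm_num)
  simp only [Pi.add_apply]
  rw [ENNReal.mul_rpow_of_nonneg _ _ (by norm_num), ENNReal.mul_rpow_of_nonneg _ _ (by norm_num),
    ENNReal.mul_rpow_of_nonneg _ _ (by norm_num), ← add_mul]
  gcongr
  exact sqrt_hsNormSq_add_le _ _

theorem IsFourierAt.add_smul {f g : L2H} (hf : Integrable f) (hg : Integrable g) {lam : ℝ}
    {S T : L2R →L[ℂ] L2R} (hS : IsFourierAt f lam S) (hT : IsFourierAt g lam T) (c : ℂ) :
    IsFourierAt (f + c • g) lam (S + c • T) := by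
  intro u v
  rw [add_apply, smul_apply, inner_add_right, inner_smul_right, hS, hT, ← integral_const_mul,
    ← integral_add (integrable_mul_inner_schrodinger hf lam u v)
      ((integrable_mul_inner_schrodinger hg lam u v).const_mul c)]
  refine integral_congr_ae ?_
  filter_upwards [Lp.coeFn_add f (c • g), Lp.coeFn_smul c g] with n h1 h2
  rw [h1, Pi.add_apply, h2, Pi.smul_apply, smul_eq_mul]
  ring

theorem isPlancherelTransform_of_isFourierAt {g : L2H} (h1 : Integrable g)
    {G : ℝ → L2R →L[ℂ] L2R} (hG : ∀ lam, lam ≠ 0 → IsFourierAt g lam (G lam)) :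
    IsPlancherelTransform g G := by
  refine ⟨weaklyMeasurable_of_isFourierAt hG, fun _ => g, fun _ => G, fun _ => h1, fun _ => hG,
    tendsto_const_nhds, ?_⟩
  simp [hsNormSq_eq]

theorem IsPlancherelTransform.weaklyMeasurable {f : L2H} {F : ℝ → L2R →L[ℂ] L2R}
    (hF : IsPlancherelTransform f F) : WeaklyMeasurable F := hF.1

theorem IsPlancherelTransform.add_smul {f g : L2H} {F G : ℝ → L2R →L[ℂ] L2R}
    (hF : IsPlancherelTransform f F) (hG : IsPlancherelTransform g G) (c : ℂ) :
    IsPlancherelTransform (f + c • g) (F + c • G) := by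
  refine ⟨hF.weaklyMeasurable.add (hG.weaklyMeasurable.smul c), ?_⟩
  obtain ⟨hFm, f', F', hf1, hf2, hf3, hf4⟩ := hF
  obtain ⟨hGm, g', G', hg1, hg2, hg3, hg4⟩ := hG
  refine ⟨fun j => f' j + c • g' j, fun j => F' j + c • G' j, fun j => ?_, fun j lam hlam => ?_,
    hf3.add (hg3.const_smul c), ?_⟩
  · refine ((hf1 j).add ((hg1 j).smul c)).congr ?_
    filter_upwards [Lp.coeFn_add (f' j) (c • g' j), Lp.coeFn_smul c (g' j)] with n h1 h2
    rw [h1, Pi.add_apply, Pi.add_apply, h2]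
  · exact (hf2 j lam hlam).add_smul (hf1 j) (hg1 j) (hg2 j lam hlam) c
  · have hlim := (ENNReal.Tendsto.const_mul (a := 2) hf4 (by simp)).add
      (ENNReal.Tendsto.const_mul (a := 2)
        (ENNReal.Tendsto.const_mul (a := ‖c‖ₑ ^ 2) hg4 (by right; finiteness)) (by simp))
    simp only [mul_zero, add_zero] at hlim
    refine tendsto_of_tendsto_of_tendsto_of_le_of_le tendsto_const_nhds hlim (fun _ => zero_le)
      fun j => ?_
    have hm1 : AEMeasurable fun lam => hsNormSq (F' j lam - F lam) * ‖lam‖ₑ :=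
      ((weaklyMeasurable_of_isFourierAt (hf2 j)).sub hFm).aemeasurable_density
    simp only
    rw [← lintegral_const_mul' _ _ (by simp), ← lintegral_const_mul' _ _ (by finiteness),
      ← lintegral_const_mul' _ _ (by simp), ← lintegral_add_left' (hm1.const_mul 2)]
    refine lintegral_mono fun lam => ?_
    have e : (F' j + c • G' j) lam - (F + c • G) lam
        = (F' j lam - F lam) + c • (G' j lam - G lam) := by
      simp only [Pi.add_apply, Pi.smul_apply, smul_sub]; abel
    rw [e]
    calc _ ≤ 2 * (hsNormSq (F' j lam - F lam) + hsNormSq (c • (G' j lam - G lam))) * ‖lam‖ₑ := by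
          gcongr; exact hsNormSq_add_le _ _
      _ = _ := by rw [hsNormSq_smul]; ring

/-- The Plancherel transform is isometric. -/
theorem IsPlancherelTransform.fieldNormSq_eq {f : L2H} {F : ℝ → L2R →L[ℂ] L2R}
    (hF : IsPlancherelTransform f F) : fieldNormSq F = ‖f‖ₑ ^ 2 := by
  have hFm := hF.weaklyMeasurable
  obtain ⟨-, g, G, hg1, hg2, hg3, hg4⟩ := hF
  have hGm : ∀ j, WeaklyMeasurable (G j) := fun j => weaklyMeasurable_of_isFourierAt (hg2 j)
  have hsq : ∀ x : ℝ≥0∞, (x ^ 2) ^ (1 / 2 : ℝ) = x := fun x => by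
    rw [← ENNReal.rpow_natCast, ← ENNReal.rpow_mul]; norm_num
  have hG : ∀ j, fieldNormSq (G j) ^ (1 / 2 : ℝ) = ‖g j‖ₑ := fun j => by
    rw [fieldNormSq, lintegral_hsNormSq_of_isFourierAt (hg1 j) (hg2 j), hsq]
  have hlim : Tendsto (fun j => fieldNormSq (G j - F) ^ (1 / 2 : ℝ)) atTop (𝓝 0) := by
    have := (ENNReal.continuous_rpow_const (y := (1 / 2 : ℝ))).tendsto 0 |>.comp hg4
    rwa [ENNReal.zero_rpow_of_pos (by norm_num)] at this
  have hn : Tendsto (fun j => ‖g j‖ₑ) atTop (𝓝 ‖f‖ₑ) := hg3.enorm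
  -- The approximating fields already satisfy the identity; the triangle inequality in both
  -- directions carries it to the limit.
  have key : fieldNormSq F ^ (1 / 2 : ℝ) = ‖f‖ₑ := by
    refine le_antisymm ?_ ?_
    · have h : Tendsto (fun j => ‖g j‖ₑ + fieldNormSq (G j - F) ^ (1 / 2 : ℝ)) atTop
          (𝓝 (‖f‖ₑ + 0)) := hn.add hlim
      rw [add_zero] at h
      refine ge_of_tendsto' h fun j => ?_
      have := sqrt_fieldNormSq_add_le (hGm j) (hFm.sub (hGm j))
      rwa [add_sub_cancel, hG, fieldNormSq_sub_comm] at this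
    · have h : Tendsto (fun j => fieldNormSq F ^ (1 / 2 : ℝ)
          + fieldNormSq (G j - F) ^ (1 / 2 : ℝ)) atTop (𝓝 (fieldNormSq F ^ (1 / 2 : ℝ) + 0)) :=
        tendsto_const_nhds.add hlim
      rw [add_zero] at h
      refine le_of_tendsto_of_tendsto' hn h fun j => ?_
      have := sqrt_fieldNormSq_add_le hFm ((hGm j).sub hFm)
      rwa [add_sub_cancel, hG] at this
  rw [← key, ← ENNReal.rpow_natCast, ← ENNReal.rpow_mul]
  norm_num

theorem IsPlancherelTransform.ae_hsNormSq_ne_top {f : L2H} {F : ℝ → L2R →L[ℂ] L2R}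
    (hF : IsPlancherelTransform f F) : ∀ᵐ lam : ℝ, hsNormSq (F lam) ≠ ∞ := by
  have h0 : ∀ᵐ x : ℝ, x ≠ 0 := by simp [ae_iff]
  have h1 : ∫⁻ lam : ℝ, hsNormSq (F lam) * ‖lam‖ₑ ≠ ∞ := by
    have := hF.fieldNormSq_eq
    rw [fieldNormSq] at this
    rw [this]; finiteness
  have h2 := ae_lt_top' hF.weaklyMeasurable.aemeasurable_density h1
  filter_upwards [h0, h2] with lam hlam h h'
  rw [h', ENNReal.top_mul (by simpa)] at h
  exact absurd h (lt_irrefl _)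

/-- By linearity the difference is a Plancherel transform of `0`, so its norm vanishes by the
isometry. -/
theorem IsPlancherelTransform.ae_eq {f : L2H} {F G : ℝ → L2R →L[ℂ] L2R}
    (hF : IsPlancherelTransform f F) (hG : IsPlancherelTransform f G) : F =ᵐ[volume] G := by
  have h := hF.add_smul hG (-1)
  rw [neg_one_smul, neg_one_smul, add_neg_cancel] at h
  have h1 := h.fieldNormSq_eq
  rw [enorm_zero, zero_pow two_ne_zero, fieldNormSq,
    lintegral_eq_zero_iff' h.weaklyMeasurable.aemeasurable_density] at h1
  have h0 : ∀ᵐ x : ℝ, x ≠ 0 := by simp [ae_iff]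
  filter_upwards [h0, h1] with lam hlam h2
  have h3 : hsNormSq ((F + -G) lam) = 0 := by
    rcases mul_eq_zero.1 h2 with h | h
    · exact h
    · exact absurd (by simpa using h) hlam
  have := eq_zero_of_hsNormSq_eq_zero h3
  rwa [Pi.add_apply, Pi.neg_apply, ← sub_eq_add_neg, sub_eq_zero] at this

theorem IsPlancherelTransform.integral_eq {f : L2H} {F : ℝ → L2R →L[ℂ] L2R}
    (hF : IsPlancherelTransform f F) :
    Integrable (fun lam : ℝ => (((hsNormSq (F lam)).toReal : ℂ)) * (|lam| : ℝ)) ∧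
    ∫ lam : ℝ, (((hsNormSq (F lam)).toReal : ℂ)) * (|lam| : ℝ) = (‖f‖ : ℂ) ^ 2 := by
  have hm := hF.weaklyMeasurable.aemeasurable_density
  have h1 := hF.fieldNormSq_eq
  rw [fieldNormSq] at h1
  have h2 : ∫⁻ lam : ℝ, hsNormSq (F lam) * ‖lam‖ₑ ≠ ∞ := by
    rw [h1]
    finiteness
  have e : ∀ lam : ℝ, (((hsNormSq (F lam)).toReal : ℂ)) * (|lam| : ℝ)
      = (((hsNormSq (F lam) * ‖lam‖ₑ).toReal : ℝ) : ℂ) := fun lam => by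
    rw [ENNReal.toReal_mul, toReal_enorm, Real.norm_eq_abs]; push_cast; rfl
  simp only [e]
  refine ⟨(integrable_toReal_of_lintegral_ne_top hm h2).ofReal, ?_⟩
  rw [integral_complex_ofReal]
  rw [integral_toReal hm (ae_lt_top' hm h2), h1]
  simp

/-- The Plancherel transform preserves inner products. -/
theorem IsPlancherelTransform.inner_eq {f g : L2H} {F G : ℝ → L2R →L[ℂ] L2R}
    (hF : IsPlancherelTransform f F) (hG : IsPlancherelTransform g G) :
    Integrable (fun lam : ℝ => hsInner (F lam) (G lam) * (|lam| : ℝ)) ∧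
    inner ℂ f g = ∫ lam : ℝ, hsInner (F lam) (G lam) * (|lam| : ℝ) := by
  have key : ∀ c : ℂ, IsPlancherelTransform (f + c • g) (F + c • G) := hF.add_smul hG
  have h1 := (key 1).integral_eq
  have h2 := (key (-1)).integral_eq
  have h3 := (key (-Complex.I)).integral_eq
  have h4 := (key Complex.I).integral_eq
  simp only [one_smul, neg_smul, ← sub_eq_add_neg] at h1 h2 h3 h4
  have e : ∀ lam : ℝ, hsInner (F lam) (G lam) * (|lam| : ℝ)
      = (((((hsNormSq ((F + G) lam)).toReal : ℂ)) * (|lam| : ℝ)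
        - (((hsNormSq ((F - G) lam)).toReal : ℂ)) * (|lam| : ℝ))
        + ((((hsNormSq ((F - Complex.I • G) lam)).toReal : ℂ)) * (|lam| : ℝ)
        - (((hsNormSq ((F + Complex.I • G) lam)).toReal : ℂ)) * (|lam| : ℝ)) * Complex.I) / 4 := by
    intro lam
    simp only [hsInner, Pi.add_apply, Pi.sub_apply, Pi.smul_apply]
    ring
  have hlin : ∀ A B C D : ℝ → ℂ, Integrable A → Integrable B → Integrable C → Integrable D →
      Integrable (fun t => ((A t - B t) + (C t - D t) * Complex.I) / 4) ∧
      ∫ t, ((A t - B t) + (C t - D t) * Complex.I) / 4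
        = ((∫ t, A t) - (∫ t, B t) + ((∫ t, C t) - (∫ t, D t)) * Complex.I) / 4 := by
    intro A B C D hA hB hC hD
    refine ⟨((hA.sub hB).add ((hC.sub hD).mul_const _)).div_const 4, ?_⟩
    rw [integral_div, integral_add (f := fun t => A t - B t)
      (g := fun t => (C t - D t) * Complex.I) (hA.sub hB) ((hC.sub hD).mul_const _),
      integral_sub hA hB, integral_mul_const, integral_sub hC hD]
  obtain ⟨r1, r2⟩ := hlin _ _ _ _ h1.1 h2.1 h3.1 h4.1
  simp only [e]
  refine ⟨r1, ?_⟩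
  rw [r2, h1.2, h2.2, h3.2, h4.2, inner_eq_sum_norm_sq_div_four]
  rfl

/-! ### Translations -/

/-- The measurable equivalence `n ↦ γ n η`. -/
def biMulEquiv (γ η : Heis) : Heis ≃ᵐ Heis where
  toFun n := γ * n * η
  invFun n := γ⁻¹ * n * η⁻¹
  left_inv n := by group
  right_inv n := by group
  measurable_toFun :=
    (measurePreserving_mul_right η).measurable.comp (measurePreserving_mul_left γ).measurable
  measurable_invFun :=
    (measurePreserving_mul_right η⁻¹).measurable.comp (measurePreserving_mul_left γ⁻¹).measurable

theorem measurePreserving_biMulEquiv (γ η : Heis) : MeasurePreserving (biMulEquiv γ η) :=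
  (measurePreserving_mul_right η).comp (measurePreserving_mul_left γ)

theorem coeFn_biregular (γ η : Heis) (f : L2H) :
    biregular (γ, η) f =ᵐ[volume] fun n => f (γ⁻¹ * n * η) := by
  have h1 : biregular (γ, η) f =ᵐ[volume] fun n => rightTranslation η f (γ⁻¹ * n) :=
    Lp.coeFn_compMeasurePreserving _ _
  have h2 : rightTranslation η f =ᵐ[volume] fun n => f (n * η) :=
    Lp.coeFn_compMeasurePreserving _ _
  have h3 := (measurePreserving_mul_left γ⁻¹).quasiMeasurePreserving.ae h2
  filter_upwards [h1, h3] with n e1 e2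
  rw [e1, e2]

theorem integrable_biregular {f : L2H} (hf : Integrable f) (γ η : Heis) :
    Integrable (biregular (γ, η) f) :=
  (((measurePreserving_biMulEquiv γ⁻¹ η).integrable_comp_emb
    (biMulEquiv γ⁻¹ η).measurableEmbedding).2 hf).congr (coeFn_biregular γ η f).symm

/-- Unitarity, from the invariance of the measure on both sides. It moves the translations from `f`,
which need not be integrable, to `h`. -/
theorem inner_biregular (γ η : Heis) (h f : L2H) :
    inner ℂ h (biregular (γ, η) f) = inner ℂ (biregular (γ⁻¹, η⁻¹) h) f := by
  rw [inner_L2_eq, inner_L2_eq, ← (measurePreserving_biMulEquiv γ η⁻¹).integral_comp']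
  refine integral_congr_ae ?_
  filter_upwards [coeFn_biregular γ⁻¹ η⁻¹ h,
    (measurePreserving_biMulEquiv γ η⁻¹).quasiMeasurePreserving.ae (coeFn_biregular γ η f)]
    with n h1 h2
  rw [h2, h1, inv_inv]
  simp only [biMulEquiv, MeasurableEquiv.coe_mk, Equiv.coe_fn_mk]
  congr 2
  group

theorem IsFourierAt.biregular {h : L2H} {lam : ℝ} {S T : L2R →L[ℂ] L2R} {γ η : Heis}
    (hS : IsFourierAt h lam S)
    (hT : IsFourierAt (HeisenbergWavelet.biregular (γ⁻¹, η⁻¹) h) lam T) (u v : L2R) :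
    inner ℂ u (T v) = inner ℂ (schrodinger lam γ u) (S (schrodinger lam η v)) := by
  rw [hS, hT, ← (measurePreserving_biMulEquiv γ⁻¹ η).integral_comp']
  refine integral_congr_ae ?_
  filter_upwards [(measurePreserving_biMulEquiv γ⁻¹ η).quasiMeasurePreserving.ae
    (coeFn_biregular γ⁻¹ η⁻¹ h)] with n hn
  rw [hn, ← inner_schrodinger_translate]
  simp only [biMulEquiv, MeasurableEquiv.coe_mk, Equiv.coe_fn_mk]
  congr 2
  group

/-! ### Dilations -/

theorem dil_dil_neg (a b : ℝˣ) (m : ℤ) (n : Heis) : dil a b m (dil a b (-m) n) = n := by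
  have ha := zpow_ne_zero m a.ne_zero
  have hb := zpow_ne_zero m b.ne_zero
  ext <;> simp only [dil, Heis.x_mk, Heis.y_mk, Heis.z_mk, zpow_neg, mul_zpow] <;> field_simp

/-- The dilations as measurable equivalences. -/
def dilEquiv (a b : ℝˣ) (m : ℤ) : Heis ≃ᵐ Heis where
  toFun := dil a b m
  invFun := dil a b (-m)
  left_inv n := by simpa using dil_dil_neg a b (-m) n
  right_inv n := dil_dil_neg a b m n
  measurable_toFun := measurable_dil a b m
  measurable_invFun := measurable_dil a b (-m)

/-- The Jacobian of the dilation is `a^m b^m (ab)^m = (ab)^{2m} = 4^m`. -/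
theorem map_dilEquiv {a b : ℝˣ} (hab : (a : ℝ) * b = 2) (m : ℤ) :
    (volume : Measure Heis).map (dilEquiv a b m) = ENNReal.ofReal ((4 : ℝ) ^ (-m)) • volume := by
  have ha := zpow_ne_zero m a.ne_zero
  have hb := zpow_ne_zero m b.ne_zero
  have hab' := zpow_ne_zero m (mul_ne_zero a.ne_zero b.ne_zero)
  have h : Measure.map (Prod.map (fun t : ℝ => (a : ℝ) ^ m * t)
      (Prod.map (fun t : ℝ => (b : ℝ) ^ m * t) (fun t : ℝ => ((a : ℝ) * b) ^ m * t)))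
      ((volume : Measure ℝ).prod ((volume : Measure ℝ).prod (volume : Measure ℝ)))
      = (ENNReal.ofReal |((a : ℝ) ^ m)⁻¹| * (ENNReal.ofReal |((b : ℝ) ^ m)⁻¹| *
        ENNReal.ofReal |(((a : ℝ) * b) ^ m)⁻¹|)) •
        ((volume : Measure ℝ).prod ((volume : Measure ℝ).prod (volume : Measure ℝ))) := by
    have i1 : SFinite (Measure.map (fun t : ℝ => (b : ℝ) ^ m * t) volume) := by infer_instance
    rw [← Measure.map_prod_map _ _ (by fun_prop) (by fun_prop),
      ← Measure.map_prod_map _ _ (by fun_prop) (by fun_prop), Real.map_volume_mul_left ha,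
      Real.map_volume_mul_left hb, Real.map_volume_mul_left hab']
    simp only [Measure.prod_smul_left, Measure.prod_smul_right, smul_smul]
    congr 1
    ring
  have e : ENNReal.ofReal |((a : ℝ) ^ m)⁻¹| * (ENNReal.ofReal |((b : ℝ) ^ m)⁻¹| *
        ENNReal.ofReal |(((a : ℝ) * b) ^ m)⁻¹|) = ENNReal.ofReal ((4 : ℝ) ^ (-m)) := by
    rw [← mul_assoc, ← ENNReal.ofReal_mul (abs_nonneg _), ← abs_mul, ← mul_inv, ← mul_zpow, hab,
      ← ENNReal.ofReal_mul (abs_nonneg _), ← abs_mul, ← mul_inv, ← mul_zpow, zpow_neg]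
    norm_num
  rw [e] at h
  exact h

theorem abs_det_rpow {a b : ℝˣ} (hab : (a : ℝ) * b = 2) (m : ℤ) :
    |(dilMatrix a b).det| ^ (-(m : ℝ) / 2) = (2 : ℝ) ^ (-m) := by
  rw [det_dilMatrix, hab, abs_of_pos (by norm_num), ← Real.rpow_natCast, ← Real.rpow_mul
    (by norm_num), ← Real.rpow_intCast]
  congr 1
  push_cast; ring

theorem coeFn_dilation {a b : ℝˣ} (hab : (a : ℝ) * b = 2) (m : ℤ) (f : L2H) :
    dilation a b m f =ᵐ[volume] fun n => (((2 : ℝ) ^ (-m) : ℝ) : ℂ) * f (dil a b (-m) n) := by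
  rw [← abs_det_rpow hab]
  exact MemLp.coeFn_toLp _

theorem quasiMeasurePreserving_dilEquiv {a b : ℝˣ} (hab : (a : ℝ) * b = 2) (m : ℤ) :
    Measure.QuasiMeasurePreserving (dilEquiv a b m) := by
  refine ⟨(dilEquiv a b m).measurable, ?_⟩
  rw [map_dilEquiv hab]
  exact Measure.smul_absolutelyContinuous

theorem integrable_dilation {a b : ℝˣ} (hab : (a : ℝ) * b = 2) (m : ℤ) {f : L2H}
    (hf : Integrable f) : Integrable (dilation a b m f) := by
  have h : Integrable f ((volume : Measure Heis).map (dilEquiv a b (-m))) := by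
    rw [map_dilEquiv hab]
    exact hf.smul_measure ENNReal.ofReal_ne_top
  exact (((dilEquiv a b (-m)).measurableEmbedding.integrable_map_iff.1 h).const_mul _).congr
    (coeFn_dilation hab m f).symm

theorem inner_dilation {a b : ℝˣ} (hab : (a : ℝ) * b = 2) (m : ℤ) (h f : L2H) :
    inner ℂ h (dilation a b m f) = inner ℂ (dilation a b (-m) h) f := by
  have e1 : ∀ G : Heis → ℂ, ∫ n, G (dilEquiv a b m n) = (((4 : ℝ) ^ (-m) : ℝ) : ℂ) * ∫ n, G n := by
    intro G
    rw [← integral_map_equiv, map_dilEquiv hab, integral_smul_measure,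
      ENNReal.toReal_ofReal (by positivity)]
    rfl
  have h4 : (((4 : ℝ) ^ m : ℝ) : ℂ) * (((4 : ℝ) ^ (-m) : ℝ) : ℂ) = 1 := by
    rw [← Complex.ofReal_mul, ← zpow_add₀ (by norm_num)]
    simp
  have e2 : ∀ G : Heis → ℂ, ∫ n, G n = (((4 : ℝ) ^ m : ℝ) : ℂ) * ∫ n, G (dilEquiv a b m n) := by
    intro G
    rw [e1, ← mul_assoc, h4, one_mul]
  rw [inner_L2_eq, inner_L2_eq, e2, ← integral_const_mul]
  refine integral_congr_ae ?_
  filter_upwards [coeFn_dilation hab (-m) h,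
    (quasiMeasurePreserving_dilEquiv hab m).ae (coeFn_dilation hab m f)] with n h1 h2
  rw [h2, h1]
  have e3 : dil a b (-m) (dilEquiv a b m n) = n := (dilEquiv a b m).left_inv n
  have e5 : dil a b m n = dilEquiv a b m n := rfl
  rw [e3, neg_neg, e5, map_mul, Complex.conj_ofReal]
  have e4 : (((4 : ℝ) ^ m : ℝ) : ℂ) * (((2 : ℝ) ^ (-m) : ℝ) : ℂ) = (((2 : ℝ) ^ m : ℝ) : ℂ) := by
    rw [← Complex.ofReal_mul, show (4 : ℝ) = 2 * 2 by norm_num, mul_zpow, mul_assoc,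
      ← zpow_add₀ (by norm_num)]
    simp
  rw [← e4]
  ring

theorem lintegral_prod_comp_mul {c d : ℝ} (hc : c ≠ 0) (hd : d ≠ 0) {φ : ℝ × ℝ → ℝ≥0∞}
    (hφ : Measurable φ) :
    ‖c * d‖ₑ * ∫⁻ p : ℝ × ℝ, φ (c * p.1, d * p.2) = ∫⁻ p : ℝ × ℝ, φ p := by
  rw [Measure.volume_eq_prod, lintegral_prod _ (by fun_prop), lintegral_prod _ (by fun_prop),
    enorm_mul, mul_assoc, ← lintegral_const_mul' _ _ (by finiteness)]
  have h : ∀ x, ‖d‖ₑ * ∫⁻ y, φ (x, d * y) = ∫⁻ y, φ (x, y) := fun x =>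
    lintegral_comp_const_mul hd fun y => φ (x, y)
  simp only [h]
  exact lintegral_comp_const_mul hc fun x => ∫⁻ y, φ (x, y)

theorem plancherelDensity_congr {f g : Heis → ℂ} (h : f =ᵐ[volume] g) (lam : ℝ) :
    plancherelDensity f lam = plancherelDensity g lam := by
  refine lintegral_congr_ae ?_
  have h1 := measurePreserving_heisEquiv.quasiMeasurePreserving.ae h
  filter_upwards [Measure.ae_ae_of_ae_prod h1] with p hp
  congr 2
  refine integral_congr_ae ?_
  filter_upwards [hp] with z hz
  simp only [heisEquiv_apply] at hz
  rw [hz]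

/-- In the central variable the normalization `2^m` cancels the Jacobian of `z ↦ 2^m z`. What
remains is the dilation of `(x, y)` by `(a^m, b^m)`, with Jacobian `(ab)^m = 2^m`. -/
theorem plancherelDensity_dilation {a b : ℝˣ} (hab : (a : ℝ) * b = 2) (m : ℤ) (h : L2H)
    (lam : ℝ) : ‖(2 : ℝ) ^ m‖ₑ * plancherelDensity (dilation a b (-m) h) ((2 : ℝ) ^ m * lam)
      = plancherelDensity h lam := by
  have hm := (Lp.stronglyMeasurable h).measurable
  have ha := zpow_ne_zero m a.ne_zero
  have hb := zpow_ne_zero m b.ne_zero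
  have h2 : (2 : ℝ) ^ m ≠ 0 := by positivity
  have hF : ∀ p : ℝ × ℝ, fourierCentral
      (fun n => (((2 : ℝ) ^ m : ℝ) : ℂ) * h (dil a b m n)) ((2 : ℝ) ^ m * lam) p
      = fourierCentral h lam ((a : ℝ) ^ m * p.1, (b : ℝ) ^ m * p.2) := by
    intro p
    have e := Measure.integral_comp_mul_left (fun z : ℝ => Complex.exp (2 * Real.pi * Complex.I *
      ((lam * z : ℝ) : ℂ)) * h (Heis.mk ((a : ℝ) ^ m * p.1) ((b : ℝ) ^ m * p.2) z)) ((2 : ℝ) ^ m)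
    rw [abs_of_pos (by positivity), eq_comm, inv_smul_eq_iff₀ h2] at e
    rw [fourierCentral, fourierCentral, e, ← integral_smul]
    refine integral_congr_ae (ae_of_all _ fun z => ?_)
    simp only [dil, Heis.x_mk, Heis.y_mk, Heis.z_mk, hab, Complex.real_smul]
    rw [show (2 : ℝ) ^ m * lam * z = lam * (2 ^ m * z) by ring]
    ring
  have hcd : plancherelDensity (dilation a b (-m) h) ((2 : ℝ) ^ m * lam)
      = ∫⁻ p : ℝ × ℝ, ‖fourierCentral h lam ((a : ℝ) ^ m * p.1, (b : ℝ) ^ m * p.2)‖ₑ ^ 2 := by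
    have h1 := coeFn_dilation hab (-m) h
    rw [neg_neg] at h1
    rw [plancherelDensity_congr h1]
    simp only [plancherelDensity, hF]
  have hmeas : Measurable fun p : ℝ × ℝ => ‖fourierCentral h lam p‖ₑ ^ 2 := by
    have : Measurable (fourierCentral h lam) :=
      (measurable_fourierCentral hm).comp measurable_prodMk_left
    fun_prop
  have := lintegral_prod_comp_mul ha hb hmeas
  rw [← mul_zpow, hab] at this
  rw [hcd, this]
  rfl

/-- After the substitution `λ ↦ 2^m λ` the term of index `m` is the integral of the density of `h`
over `2^{-m} S`, and these sets tile the line. -/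
theorem tsum_setLIntegral_plancherelDensity_dilation {a b : ℝˣ} (hab : (a : ℝ) * b = 2)
    {S : Set ℝ} (hS : MeasurableSet S) (htile : ∀ᵐ x : ℝ, ∃! n : ℤ, (2 : ℝ) ^ n * x ∈ S)
    (h : L2H) : ∑' m : ℤ, ∫⁻ lam in S, plancherelDensity (dilation a b (-m) h) lam
      = ∫⁻ lam, plancherelDensity h lam := by
  have hm := measurable_plancherelDensity (Lp.stronglyMeasurable h).measurable
  have e : ∀ m : ℤ, ∫⁻ lam in S, plancherelDensity (dilation a b (-m) h) lam
      = ∫⁻ lam, S.indicator 1 ((2 : ℝ) ^ m * lam) * plancherelDensity h lam := by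
    intro m
    have h2 : (2 : ℝ) ^ m ≠ 0 := by positivity
    rw [← lintegral_indicator hS, ← lintegral_comp_const_mul h2,
      ← lintegral_const_mul' _ _ (by finiteness)]
    refine lintegral_congr fun lam => ?_
    by_cases hx : (2 : ℝ) ^ m * lam ∈ S
    · rw [Set.indicator_of_mem hx, Set.indicator_of_mem hx, plancherelDensity_dilation hab,
        Pi.one_apply, one_mul]
    · rw [Set.indicator_of_notMem hx, Set.indicator_of_notMem hx, mul_zero, zero_mul]
  simp only [e]
  rw [← lintegral_tsum fun m => ?_]
  · refine lintegral_congr_ae ?_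
    filter_upwards [htile] with lam ⟨n, hn, hu⟩
    rw [tsum_eq_single n]
    · rw [Set.indicator_of_mem hn, Pi.one_apply, one_mul]
    · intro k hk
      rw [Set.indicator_of_notMem fun hk' => hk (hu k hk'), zero_mul]
  · have : Measurable fun lam : ℝ => S.indicator (1 : ℝ → ℝ≥0∞) ((2 : ℝ) ^ m * lam) :=
      (measurable_one.indicator hS).comp (measurable_const_mul _)
    exact (this.mul hm).aemeasurable

/-! ### Parseval frames and density -/

/-- The upper bound is a closed condition for each finite partial sum, so it extends from `D`. It
makes the seminorm `L` continuous, and then the lower bound extends too. -/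
theorem isParsevalFrame_of_dense {E ι : Type*} [NormedAddCommGroup E] [InnerProductSpace ℂ E]
    {e : ι → E} {D : Set E} (hD : Dense D)
    (h : ∀ x ∈ D, ∑' i, ‖inner ℂ x (e i)‖ₑ ^ 2 = ‖x‖ₑ ^ 2) : IsParsevalFrame e := by
  have hsq : ∀ x : ℝ≥0∞, (x ^ 2) ^ (1 / 2 : ℝ) = x := fun x => by
    rw [← ENNReal.rpow_natCast, ← ENNReal.rpow_mul]; norm_num
  set L : E → ℝ≥0∞ := fun x => (∑' i, ‖inner ℂ x (e i)‖ₑ ^ 2) ^ (1 / 2 : ℝ) with hL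
  have hLD : ∀ x ∈ D, L x = ‖x‖ₑ := fun x hx => by rw [hL]; simp only; rw [h x hx, hsq]
  have hle : ∀ x, ∑' i, ‖inner ℂ x (e i)‖ₑ ^ 2 ≤ ‖x‖ₑ ^ 2 := by
    intro x
    rw [ENNReal.tsum_eq_iSup_sum]
    refine iSup_le fun s => ?_
    have hc : IsClosed {x : E | ∑ i ∈ s, ‖inner ℂ x (e i)‖ₑ ^ 2 ≤ ‖x‖ₑ ^ 2} :=
      isClosed_le (by fun_prop) (by fun_prop)
    exact hD.induction (P := fun x => ∑ i ∈ s, ‖inner ℂ x (e i)‖ₑ ^ 2 ≤ ‖x‖ₑ ^ 2)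
      (fun y hy => (ENNReal.sum_le_tsum s).trans (h y hy).le) hc x
  have hle' : ∀ x, L x ≤ ‖x‖ₑ := fun x => by
    rw [← hsq ‖x‖ₑ]
    exact ENNReal.rpow_le_rpow (hle x) (by norm_num)
  have hadd : ∀ x y, L (x + y) ≤ L x + L y := fun x y => by
    simp only [hL, inner_add_left]
    exact sqrt_tsum_enorm_add_sq_le _ _
  have hge : ∀ x, ‖x‖ₑ ≤ L x := by
    intro x
    obtain ⟨y, hyD, hy⟩ := mem_closure_iff_seq_limit.1 (hD x)
    have l1 : Tendsto (fun n => ‖y n‖ₑ) atTop (𝓝 ‖x‖ₑ) := hy.enorm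
    have l2 : Tendsto (fun n => L x + ‖y n - x‖ₑ) atTop (𝓝 (L x + 0)) := by
      refine tendsto_const_nhds.add ?_
      have := (hy.sub_const x).enorm
      rwa [sub_self, enorm_zero] at this
    rw [add_zero] at l2
    refine le_of_tendsto_of_tendsto' l1 l2 fun n => ?_
    rw [← hLD _ (hyD n)]
    calc L (y n) = L (x + (y n - x)) := by rw [add_sub_cancel]
      _ ≤ L x + L (y n - x) := hadd _ _
      _ ≤ _ := by gcongr; exact hle' _
  refine isParsevalFrame_of_tsum_enorm fun x => le_antisymm (hle x) ?_
  have h1 : ‖x‖ₑ ^ 2 ≤ L x ^ 2 := by gcongr; exact hge x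
  refine h1.trans (le_of_eq ?_)
  rw [hL, ← ENNReal.rpow_natCast, ← ENNReal.rpow_mul]
  norm_num

theorem dense_integrable : Dense {h : L2H | Integrable h} := by
  have h := Lp.simpleFunc.denseRange (E := ℂ) (p := 2) (μ := (volume : Measure Heis))
    (by norm_num)
  refine h.mono ?_
  rintro _ ⟨s, rfl⟩
  have h1 := (SimpleFunc.memLp_iff_integrable (by norm_num) (by norm_num)).1
    (Lp.simpleFunc.memLp s)
  exact h1.congr (Lp.simpleFunc.toSimpleFunc_eq_toFun s)

/-! ### The matrix coefficients of the system -/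

/-- The inner products with the translates of a function whose Plancherel transform is a field of
rank-one operators supported on `S`. -/
theorem exists_integrable_inner_biregular {S : Set ℝ} {f : L2H}
    {F : ℝ → L2R →L[ℂ] L2R} (hF : IsPlancherelTransform f F)
    (hF0 : ∀ᵐ lam : ℝ, lam ∉ S → F lam = 0) {u v : ℝ → L2R}
    (hFuv : ∀ᵐ lam : ℝ, lam ∈ S → F lam = InnerProductSpace.rankOne ℂ (u lam) (v lam))
    {h : L2H} (hh : Integrable h) {H : ℝ → L2R →L[ℂ] L2R} (hH : ∀ lam, IsFourierAt h lam (H lam))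
    (γ η : Heis) : ∃ ψ : ℝ → ℂ, Integrable ψ ∧
      inner ℂ h (biregular (γ, η) f) = ∫ lam in S, ψ lam ∧
      ∀ᵐ lam : ℝ, lam ∈ S → ψ lam = inner ℂ (H lam (schrodinger lam η (v lam)))
        (schrodinger lam γ (u lam)) * (|lam| : ℝ) := by
  have hh' := integrable_biregular hh γ⁻¹ η⁻¹
  choose T hT using fun lam => exists_isFourierAt hh' lam
  have hTP := isPlancherelTransform_of_isFourierAt hh' fun lam _ => hT lam
  obtain ⟨hi, he⟩ := hTP.inner_eq hF
  -- The witness is the Hilbert–Schmidt pairing with `F`, weighted by `|λ|`. It is integrable on the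
  -- whole line and vanishes almost everywhere off `S`.
  refine ⟨_, hi, ?_, ?_⟩
  · rw [inner_biregular, he, setIntegral_eq_integral_of_ae_compl_eq_zero]
    filter_upwards [hF0] with lam h0 hlam
    rw [h0 hlam, hsInner_zero_right, zero_mul]
  · filter_upwards [hFuv, hTP.ae_hsNormSq_ne_top] with lam h1 h2 hlam
    rw [h1 hlam, hsInner_rankOne h2, ← inner_conj_symm, (hH lam).biregular (hT lam),
      inner_conj_symm]

/-- The Hilbert-Schmidt norm in terms of a pair of Gabor frames. -/
theorem tsum_tsum_enorm_inner_gabor {lam : ℝ} {u v : L2R}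
    (hu : IsParsevalFrame (gabor 1 lam (((|lam| ^ (1 / 4 : ℝ) : ℝ) : ℂ) • u)))
    (hv : IsParsevalFrame (gabor 1 lam (((|lam| ^ (1 / 4 : ℝ) : ℝ) : ℂ) • star v)))
    (T : L2R →L[ℂ] L2R) :
    ∑' q : ℤ × ℤ, ∑' p : ℤ × ℤ,
      ‖inner ℂ (T (gabor 1 lam v q)) (gabor 1 lam u p) * (|lam| : ℝ)‖ₑ ^ 2
      = ‖lam‖ₑ * hsNormSq T := by
  -- Each of the two frames absorbs a factor `c²`, together `c⁴ = |λ|`. Of the `|λ|²` on the left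
  -- exactly one power remains.
  set c : ℝ := |lam| ^ (1 / 4 : ℝ) with hc
  have hc4 : c ^ 4 = |lam| := by
    rw [hc, ← Real.rpow_natCast, ← Real.rpow_mul (abs_nonneg _)]
    norm_num
  have hl : ‖((|lam| : ℝ) : ℂ)‖ₑ = ‖lam‖ₑ := by
    rw [← ofReal_norm, ← ofReal_norm, Complex.norm_real]
    simp
  have hcl : ‖(c : ℂ)‖ₑ ^ 4 = ‖lam‖ₑ := by
    rw [← enorm_pow, ← Complex.ofReal_pow, hc4, hl]
  rw [← tsum_enorm_apply_sq (tsum_enorm_inner_gabor_of_star hv), ← ENNReal.tsum_mul_left]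
  refine tsum_congr fun q => ?_
  rw [← tsum_enorm_inner_gabor hu, ← ENNReal.tsum_mul_left]
  refine tsum_congr fun p => ?_
  rw [map_smul, inner_smul_left, inner_smul_right, enorm_mul, enorm_mul, enorm_mul,
    RCLike.enorm_conj, hl, ← hcl]
  ring

/-- For fixed Gabor indices the coefficients in the central integer are Fourier coefficients on `S`
of one function. Parseval for this integer, then the Gabor frames under the integral sign, produce
the density. -/
theorem tsum_enorm_inner_biregular {S : Set ℝ} (hS : MeasurableSet S)
    (htile : ∀ᵐ x : ℝ, ∃! n : ℤ, x + n ∈ S) {f : L2H}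
    {F : ℝ → L2R →L[ℂ] L2R} (hF : IsPlancherelTransform f F)
    (hF0 : ∀ᵐ lam : ℝ, lam ∉ S → F lam = 0) {u v : ℝ → L2R}
    (hFuv : ∀ᵐ lam : ℝ, lam ∈ S → F lam = InnerProductSpace.rankOne ℂ (u lam) (v lam))
    (hu : ∀ᵐ lam : ℝ, lam ∈ S →
      IsParsevalFrame (gabor 1 lam (((|lam| ^ (1 / 4 : ℝ) : ℝ) : ℂ) • u lam)))
    (hv : ∀ᵐ lam : ℝ, lam ∈ S →
      IsParsevalFrame (gabor 1 lam (((|lam| ^ (1 / 4 : ℝ) : ℝ) : ℂ) • star (v lam))))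
    {h : L2H} (hh : Integrable h) :
    ∑' i : ((ℤ × ℤ) × (ℤ × ℤ)) × ℤ, ‖inner ℂ h (biregular
        (Heis.mk i.1.2.1 i.1.2.2 i.2, Heis.mk i.1.1.1 i.1.1.2 0) f)‖ₑ ^ 2
      = ∫⁻ lam in S, plancherelDensity h lam := by
  choose H hH using fun lam => exists_isFourierAt hh lam
  have key := exists_integrable_inner_biregular hF hF0 hFuv hh hH
  -- The integrands with central integer `0`; those with central integer `k` differ from them on `S`
  -- only by `e^{2πiλk}`.
  choose φ hφi hφe hφ using fun i : (ℤ × ℤ) × (ℤ × ℤ) =>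
    key (Heis.mk i.2.1 i.2.2 0) (Heis.mk i.1.1 i.1.2 0)
  have h0 : ∀ᵐ lam : ℝ, lam ≠ 0 := by simp [ae_iff]
  have hsum : ∀ᵐ lam ∂(volume.restrict S), ∑' i, ‖φ i lam‖ₑ ^ 2 = plancherelDensity h lam := by
    rw [ae_restrict_iff' hS]
    filter_upwards [ae_all_iff.2 hφ, hu, hv, ae_enorm_mul_hsNormSq hh]
      with lam h1 hulam hvlam h2 hlam
    have e : (Equiv.prodCongr (Equiv.refl ℤ) (Equiv.neg ℤ) : ℤ × ℤ → ℤ × ℤ)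
      = fun p => (p.1, -p.2) := rfl
    rw [← h2 _ (hH lam), ← tsum_tsum_enorm_inner_gabor (hulam hlam) (hvlam hlam), ENNReal.tsum_prod',
      ← (Equiv.prodCongr (Equiv.refl ℤ) (Equiv.neg ℤ)).tsum_eq]
    refine tsum_congr fun q => ?_
    rw [← (Equiv.prodCongr (Equiv.refl ℤ) (Equiv.neg ℤ)).tsum_eq]
    refine tsum_congr fun p => ?_
    rw [h1 _ hlam, e]
    simp only [schrodinger_int_zero, neg_neg]
  have hmφ : ∀ i, AEMeasurable (fun lam => ‖φ i lam‖ₑ ^ 2) (volume.restrict S) := fun i =>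
    (hφi i).aestronglyMeasurable.restrict.enorm.pow_const 2
  have hfin : ∫⁻ lam in S, plancherelDensity h lam < ∞ := by
    have h2 : ∫⁻ n, ‖h n‖ₑ ^ 2 < ∞ := by rw [lintegral_enorm_sq_L2]; finiteness
    refine (setLIntegral_le_lintegral _ _).trans_lt ?_
    rwa [lintegral_plancherelDensity (Lp.stronglyMeasurable h).measurable hh h2]
  have hmem : ∀ i, MemLp (φ i) 2 (volume.restrict S) := fun i => by
    refine (memLp_two_iff_lintegral (hφi i).aestronglyMeasurable.restrict).2 ?_
    -- Square integrability on `S`, which the Fourier series need, holds because each `‖φ i‖²` is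
    -- one term of a sum equal to the integrable density.
    refine lt_of_le_of_lt (lintegral_mono_ae ?_) hfin
    filter_upwards [hsum] with lam hl
    rw [← hl]
    exact ENNReal.le_tsum i
  rw [ENNReal.tsum_prod', ← lintegral_congr_ae hsum, lintegral_tsum hmφ]
  refine tsum_congr fun i => ?_
  rw [← tsum_enorm_setIntegral_exp_sq hS htile (hmem i)]
  refine tsum_congr fun k => ?_
  obtain ⟨ψ, -, hψe, hψ⟩ := key (Heis.mk i.2.1 i.2.2 k) (Heis.mk i.1.1 i.1.2 0)
  rw [hψe]
  congr 2
  refine setIntegral_congr_ae hS ?_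
  filter_upwards [hψ, hφ i] with lam h1 h2 hlam
  rw [h1 hlam, h2 hlam, schrodinger_int, schrodinger_int_zero lam i.2.2, inner_smul_right, mul_assoc]

/-- The parametrization of `Lam` by integers. -/
def lamEquiv : ((ℤ × ℤ) × (ℤ × ℤ)) × ℤ ≃ Lam :=
  Equiv.ofBijective (fun i => ⟨(Heis.mk i.1.2.1 i.1.2.2 i.2, Heis.mk i.1.1.1 i.1.1.2 0),
    i.2, i.1.2.2, i.1.2.1, i.1.1.2, i.1.1.1, rfl⟩) <| by
  constructor
  · rintro ⟨⟨⟨a, b⟩, c, d⟩, e⟩ ⟨⟨⟨a', b'⟩, c', d'⟩, e'⟩ h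
    have h' := Subtype.ext_iff.1 h
    have h1 := congrArg Prod.fst h'
    have h2 := congrArg Prod.snd h'
    have e1 : (c : ℝ) = c' := congrArg Heis.x h1
    have e2 : (d : ℝ) = d' := congrArg Heis.y h1
    have e3 : (e : ℝ) = e' := congrArg Heis.z h1
    have e4 : (a : ℝ) = a' := congrArg Heis.x h2
    have e5 : (b : ℝ) = b' := congrArg Heis.y h2
    rw [Int.cast_inj] at e1 e2 e3 e4 e5
    rw [e1, e2, e3, e4, e5]
  · rintro ⟨_, k₁, k₂, k₃, m₂, m₃, rfl⟩
    exact ⟨(((m₃, m₂), (k₃, k₂)), k₁), rfl⟩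

theorem isParsevalFrame_dilation_biregular {a b : ℝˣ} (hab : (a : ℝ) * b = 2)
    {S : Set ℝ} (hS : MeasurableSet S) (hdil : ∀ᵐ x : ℝ, ∃! n : ℤ, (2 : ℝ) ^ n * x ∈ S)
    (htile : ∀ᵐ x : ℝ, ∃! n : ℤ, x + n ∈ S) {f : L2H}
    {F : ℝ → L2R →L[ℂ] L2R} (hF : IsPlancherelTransform f F)
    (hF0 : ∀ᵐ lam : ℝ, lam ∉ S → F lam = 0) {u v : ℝ → L2R}
    (hFuv : ∀ᵐ lam : ℝ, lam ∈ S → F lam = InnerProductSpace.rankOne ℂ (u lam) (v lam))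
    (hu : ∀ᵐ lam : ℝ, lam ∈ S →
      IsParsevalFrame (gabor 1 lam (((|lam| ^ (1 / 4 : ℝ) : ℝ) : ℂ) • u lam)))
    (hv : ∀ᵐ lam : ℝ, lam ∈ S →
      IsParsevalFrame (gabor 1 lam (((|lam| ^ (1 / 4 : ℝ) : ℝ) : ℂ) • star (v lam)))) :
    IsParsevalFrame (fun i : ℤ × Lam => dilation a b i.1 (biregular i.2 f)) := by
  refine isParsevalFrame_of_dense dense_integrable fun h hh => ?_
  have h2 : ∫⁻ n, ‖h n‖ₑ ^ 2 < ∞ := by rw [lintegral_enorm_sq_L2]; finiteness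
  rw [ENNReal.tsum_prod', ← lintegral_enorm_sq_L2,
    ← lintegral_plancherelDensity (Lp.stronglyMeasurable h).measurable hh h2,
    ← tsum_setLIntegral_plancherelDensity_dilation hab hS hdil]
  refine tsum_congr fun m => ?_
  rw [← tsum_enorm_inner_biregular hS htile hF hF0 hFuv hu hv (integrable_dilation hab (-m) hh),
    ← lamEquiv.tsum_eq]
  refine tsum_congr fun i => ?_
  rw [inner_dilation hab]
  rfl

end

end HeisenbergWavelet

/-- A function on the Heisenberg group whose Plancherel transform is a field of rank-one operators
`u_λ ⊗ v_λ` over a set `S` that tiles by integer translations and by dyadic dilations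
generates a Parseval wavelet frame, if the fields `u` and `v` generate Parseval Gabor frames.
Here `(u ⊗ v) w = ⟨w, v⟩ u`, and `star v` is the complex conjugate of `v`. -/
theorem theorem1p3 (a b : ℝˣ) (hab : (a : ℝ) * b = 2)
    (S : Set ℝ) (hS : MeasurableSet S) (hS1 : S ⊆ Set.Icc (-1) 1)
    (hdil : DilationCongruent S (Set.Ico (-1) (-1 / 2) ∪ Set.Ioc (1 / 2) 1))
    (htrans : TranslationCongruent S (Set.Ioc 0 1))
    (f : L2H) (hf : f ∈ bandSpace S)
    (F : ℝ → L2R →L[ℂ] L2R) (hF : IsPlancherelTransform f F)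
    (u v : ℝ → L2R)
    (hFuv : ∀ᵐ lam : ℝ, lam ∈ S → F lam = InnerProductSpace.rankOne ℂ (u lam) (v lam))
    (hu : ∀ᵐ lam : ℝ, lam ∈ S →
      IsParsevalFrame (gabor 1 lam (((|lam| ^ (1 / 4 : ℝ) : ℝ) : ℂ) • u lam)))
    (hv : ∀ᵐ lam : ℝ, lam ∈ S →
      IsParsevalFrame (gabor 1 lam (((|lam| ^ (1 / 4 : ℝ) : ℝ) : ℂ) • star (v lam)))) :
    IsParsevalFrame (fun i : ℤ × Lam => dilation a b i.1 (biregular i.2 f)) := by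
  obtain ⟨F', hF', h0⟩ := hf
  refine isParsevalFrame_dilation_biregular hab hS hdil.ae_existsUnique htrans.ae_existsUnique hF
    ?_ hFuv hu hv
  -- Membership in `bandSpace` speaks of some representative `F'`; uniqueness of the Plancherel
  -- transform carries the vanishing off `S` over to `F`.
  filter_upwards [hF.ae_eq hF', h0] with lam h1 h2 hlam
  rw [h1, h2 hlam]
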